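/- Let $\mathrm{SL}(2)=\{M\in\mathbb{R}^{2\times 2}\mid \det M=1\}$ and \[ X_1=\tfrac12\begin{pmatrix}1&0\\0&-1\end{pmatrix},\qquad X_2=\tfrac12\begin{pmatrix}0&1\\1&0\end{pmatrix}. \] Equip $\mathrm{SL}(2)$ with the left-invariant sub-Riemannian structure for which the vector fields $X_1(q)=qX_1$ and $X_2(q)=qX_2$ form an orthonormal frame of the distribution. Its Hamiltonian is the function $H(q,\lambda)=\tfrac12\left(\langle\lambda,X_1(q)\rangle^2+\langle\lambda,X_2(q)\rangle^2\right)$ on $\mathrm{T}^*(\mathrm{SL}(2))$. Let $\overrightarrow{H}$ be its Hamiltonian vector field with respect to the canonical symplectic form $\sigma$, that is, $\sigma(\cdot,\overrightarrow{H})=\mathrm{d}H$, and let $\pi:\mathrm{T}^*(\mathrm{SL}(2))\to\mathrm{SL}(2)$ be the projection. For $q\in\mathrm{SL}(2)$, the sub-Riemannian exponential map at $q$ is $\exp_q(\lambda_0)=\pi(\lambda(1))$, where $\lambda$ is the solution of $\dot\lambda=\overrightarrow{H}(\lambda)$ with $\lambda(0)=(q,\lambda_0)$; a covector $\lambda_0\in\mathrm{T}^*_q(\mathrm{SL}(2))$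 at which $\exp_q$ is defined is called conjugate, $\lambda_0\in\mathrm{Conj}_q(\mathrm{SL}(2))$, if $\mathrm{Ker}(\mathrm{d}_{\lambda_0}\exp_q)\neq\{0\}$. **Proposition.** For every $q\in\mathrm{SL}(2)$, the exponential map $\exp_q$ is defined on all of $\mathrm{T}^*_q(\mathrm{SL}(2))$ and, for every conjugate covector $\lambda_0\in\mathrm{Conj}_q(\mathrm{SL}(2))$ and every neighbourhood $U$ of $\lambda_0$ in $\mathrm{T}^*_q(\mathrm{SL}(2))$, the restriction of $\exp_q:\mathrm{T}^*_q(\mathrm{SL}(2))\to\mathrm{SL}(2)$ to $U$ is not injective. -/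

import Mathlib

open scoped Topology MatrixGroups

noncomputable section

namespace SubRiemannianSL2

/-- The ambient space of real `2 × 2` matrices, in which `SL(2)` is the level set `det = 1`.
It is written as a space of functions, so that it carries the topology and the normed space
structure of a finite product of copies of `ℝ`. -/
abbrev Mat : Type := Fin 2 → Fin 2 → ℝ

/-- The matrix product. -/
def mul (A B : Mat) : Mat := Matrix.of.symm (Matrix.of A * Matrix.of B)

/-- The determinant. -/
def det (A : Mat) : ℝ := (Matrix.of A).det

/-- The matrix underlying an element of `SL(2)`. -/
def mat (q : SL(2, ℝ)) : Mat := Matrix.of.symm q.1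

/-- The basis `X₀, X₁, X₂` of the Lie algebra of traceless matrices. -/
def X₀ : Mat := (1 / 2 : ℝ) • ![![0, -1], ![1, 0]]

/-- See `X₀`. -/
def X₁ : Mat := (1 / 2 : ℝ) • ![![1, 0], ![0, -1]]

/-- See `X₀`. -/
def X₂ : Mat := (1 / 2 : ℝ) • ![![0, 1], ![1, 0]]

theorem bracket_relations :
    mul X₁ X₂ - mul X₂ X₁ = -X₀ ∧ mul X₂ X₀ - mul X₀ X₂ = X₁ ∧ mul X₀ X₁ - mul X₁ X₀ = X₂ := by
  refine ⟨?_, ?_, ?_⟩ <;> ext i j <;> fin_cases i <;> fin_cases j <;>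
    norm_num [mul, X₀, X₁, X₂, Matrix.mul_apply, Fin.sum_univ_two]

/-- The linear form `A ↦ tr (M⁻¹ A)` for `det M = 1`, in which `M⁻¹` is the adjugate of `M`. -/
def traceForm (M : Mat) : Mat →ₗ[ℝ] ℝ where
  toFun A := ((Matrix.of M).adjugate * Matrix.of A).trace
  map_add' A B := by
    rw [← Matrix.of_add_of, mul_add, Matrix.trace_add]
  map_smul' c A := by
    rw [← Matrix.smul_of, Matrix.mul_smul, Matrix.trace_smul]
    rfl

/-- The tangent space of `SL(2)` at `q`, consisting of the `A` for which `q⁻¹ A` is traceless. -/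
def TangentSL (q : SL(2, ℝ)) : Submodule ℝ Mat := LinearMap.ker (traceForm (mat q))

/-- The tangent space is the left translate by `q` of the space of traceless matrices. -/
theorem mem_tangentSL_iff (q : SL(2, ℝ)) (A : Mat) :
    A ∈ TangentSL q ↔ ((q⁻¹ : SL(2, ℝ)).1 * Matrix.of A).trace = 0 := by
  rw [Matrix.SpecialLinearGroup.coe_inv]
  rfl

/-- The form `traceForm M` is the differential of the determinant at `M`. -/
theorem hasFDerivAt_det (M : Mat) :
    HasFDerivAt det (LinearMap.toContinuousLinearMap (traceForm M)) M := by
  have h : ∀ i j : Fin 2, HasFDerivAt (fun N : Mat => N i j)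
      ((ContinuousLinearMap.proj (R := ℝ) (φ := fun _ : Fin 2 => ℝ) j).comp
        (ContinuousLinearMap.proj (R := ℝ) (φ := fun _ : Fin 2 => Fin 2 → ℝ) i)) M := fun i j =>
    ((ContinuousLinearMap.proj (R := ℝ) (φ := fun _ : Fin 2 => ℝ) j).comp
        (ContinuousLinearMap.proj (R := ℝ) (φ := fun _ : Fin 2 => Fin 2 → ℝ) i)).hasFDerivAt
  have hd : det = fun N : Mat => N 0 0 * N 1 1 - N 0 1 * N 1 0 := by
    funext N
    exact Matrix.det_fin_two _
  rw [hd]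
  refine (((h 0 0).mul (h 1 1)).sub ((h 0 1).mul (h 1 0))).congr_fderiv ?_
  refine ContinuousLinearMap.ext fun A => ?_
  simp [traceForm, Matrix.adjugate_fin_two, Matrix.trace_fin_two, Matrix.vecHead, Matrix.vecTail]
  ring

/-- The cotangent space of `SL(2)` at `q`, the dual of the tangent space. -/
abbrev CotangentSL (q : SL(2, ℝ)) : Type := StrongDual ℝ (TangentSL q)

/-- The cotangent bundle `Mat × Mat*` of the ambient space of matrices. -/
abbrev AmbientCotangent : Type := Mat × StrongDual ℝ Mat

theorem existsUnique_representative (q : SL(2, ℝ)) (ℓ : CotangentSL q) :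
    ∃! p : StrongDual ℝ Mat, p (mat q) = 0 ∧ ∀ A : TangentSL q, p A.1 = ℓ A := by
  have htq : traceForm (mat q) (mat q) = 2 := by
    change (q.1.adjugate * q.1).trace = 2
    rw [Matrix.adjugate_mul, q.2]
    simp
  let P : Mat →ₗ[ℝ] Mat :=
    LinearMap.id - ((traceForm (mat q)).smulRight ((1 / 2 : ℝ) • mat q))
  have hPA : ∀ A, P A = A - traceForm (mat q) A • ((1 / 2 : ℝ) • mat q) := fun A => rfl
  have hP : ∀ A, P A ∈ TangentSL q := by
    intro A
    change traceForm (mat q) (P A) = 0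
    rw [hPA, map_sub, map_smul, map_smul, htq]
    simp
  refine ⟨LinearMap.toContinuousLinearMap (ℓ.toLinearMap.comp (P.codRestrict _ hP)), ⟨?_, ?_⟩, ?_⟩
  · change ℓ (P.codRestrict _ hP (mat q)) = 0
    have : P.codRestrict _ hP (mat q) = 0 := by
      apply Subtype.ext
      change P (mat q) = 0
      rw [hPA, htq, smul_smul]
      norm_num
    rw [this, map_zero]
  · intro A
    change ℓ (P.codRestrict _ hP A.1) = ℓ A
    congr 1
    apply Subtype.ext
    change P A.1 = A.1
    have : traceForm (mat q) A.1 = 0 := A.2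
    rw [hPA, this, zero_smul, sub_zero]
  · rintro p ⟨hp, hpA⟩
    refine ContinuousLinearMap.ext fun A => ?_
    change p A = ℓ (P.codRestrict _ hP A)
    rw [← hpA]
    change p A = p (P A)
    rw [hPA, map_sub, map_smul, map_smul, hp]
    simp

/-- The cotangent bundle of `SL(2)`, as a submanifold of `Mat × Mat*`. Since `Mat` is the direct
sum of the tangent space at `q` and the line through `q`, a covector on the tangent space at `q`
is the restriction of exactly one linear form `p` on `Mat` with `p q = 0`
(`existsUnique_representative`); the point `(q, p)` stands for that covector. -/
def CotangentBundleSL : Set AmbientCotangent :=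
  {z | det z.1 = 1 ∧ z.2 z.1 = 0}

/-- The tangent space at `z = (q, p)` of the cotangent bundle of `SL(2)`, that is, the vectors
`(B, β)` killed by the differentials of the two equations `det q = 1` and `p q = 0`
(`mem_tangentOfCotangent_iff`). -/
def TangentOfCotangent (z : AmbientCotangent) : Set AmbientCotangent :=
  {η | traceForm z.1 η.1 = 0 ∧ η.2 z.1 + z.2 η.1 = 0}

theorem mem_tangentOfCotangent_iff (z η : AmbientCotangent) :
    η ∈ TangentOfCotangent z ↔
      fderiv ℝ (fun y : AmbientCotangent => det y.1) z η = 0 ∧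
      fderiv ℝ (fun y : AmbientCotangent => y.2 y.1) z η = 0 := by
  have h1 : HasFDerivAt (fun y : AmbientCotangent => det y.1)
      ((LinearMap.toContinuousLinearMap (traceForm z.1)).comp
        (ContinuousLinearMap.fst ℝ Mat (StrongDual ℝ Mat))) z :=
    (hasFDerivAt_det z.1).comp z (hasFDerivAt_fst (p := z))
  have h2 := (hasFDerivAt_snd (𝕜 := ℝ) (p := z)).clm_apply (hasFDerivAt_fst (𝕜 := ℝ) (p := z))
  rw [h1.fderiv, h2.fderiv]
  simp [TangentOfCotangent, add_comm]

/-- The canonical symplectic form `dp ∧ dq` of `Mat × Mat*`. On vectors tangent to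
`CotangentBundleSL` it is the canonical symplectic form of the cotangent bundle of `SL(2)`: the
tautological one-form `(B, β) ↦ p B` of `Mat × Mat*` restricts to the tautological one-form
of the cotangent bundle of `SL(2)`. -/
def sympl (η ξ : AmbientCotangent) : ℝ := η.2 ξ.1 - ξ.2 η.1

/-- `ξ` is the value at `z` of the Hamiltonian vector field of (the restriction to the cotangent
bundle of `SL(2)` of) the function `a`: it is tangent to the cotangent bundle, and
`σ(η, ξ) = d_z a (η)` for all tangent vectors `η`. -/
def IsHamiltonianVector (a : AmbientCotangent → ℝ) (z ξ : AmbientCotangent) : Prop :=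
  ξ ∈ TangentOfCotangent z ∧ ∀ η ∈ TangentOfCotangent z, sympl η ξ = fderiv ℝ a z η

/-- The sub-Riemannian Hamiltonian `½ (⟨p, X₁(q)⟩² + ⟨p, X₂(q)⟩²)` of the structure for which
the left-invariant vector fields `X₁(q) = q X₁` and `X₂(q) = q X₂` are an orthonormal frame. -/
def hamiltonian (z : AmbientCotangent) : ℝ :=
  (1 / 2) * ((z.2 (mul z.1 X₁)) ^ 2 + (z.2 (mul z.1 X₂)) ^ 2)

/-- `z` is, on `[0, 1]`, the normal extremal in the cotangent bundle of `SL(2)` with initial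
covector `ℓ` at `q`: the solution of Hamilton's equation issued from `(q, ℓ)`. -/
structure IsNormalExtremal (q : SL(2, ℝ)) (ℓ : CotangentSL q) (z : ℝ → AmbientCotangent) :
    Prop where
  start_base : (z 0).1 = mat q
  start_covector : ∀ A : TangentSL q, (z 0).2 A.1 = ℓ A
  mem : ∀ t ∈ Set.Icc (0 : ℝ) 1, z t ∈ CotangentBundleSL
  deriv : ∀ t ∈ Set.Icc (0 : ℝ) 1, ∃ ξ : AmbientCotangent,
    IsHamiltonianVector hamiltonian (z t) ξ ∧ HasDerivWithinAt z ξ (Set.Icc (0 : ℝ) 1) t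

/-- The set of covectors at `q` whose normal extremal is defined on the whole of `[0, 1]`. -/
def expDomain (q : SL(2, ℝ)) : Set (CotangentSL q) :=
  {ℓ | ∃ z, IsNormalExtremal q ℓ z}

open Classical in
/-- The sub-Riemannian exponential map at `q`: the base point at time `1` of the normal extremal
with initial covector `ℓ` (with the value `1` outside `expDomain q`). -/
def expSL (q : SL(2, ℝ)) (ℓ : CotangentSL q) : SL(2, ℝ) :=
  if h : ∃ z, IsNormalExtremal q ℓ z then
    ⟨Matrix.of (h.choose 1).1, (h.choose_spec.mem 1 (by simp)).1⟩
  else 1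

/-- The differential of the exponential map at `ℓ`, seen with values in the ambient space of
matrices, of which `SL(2)` is an embedded submanifold. -/
def dexpSL (q : SL(2, ℝ)) (ℓ : CotangentSL q) : CotangentSL q →L[ℝ] Mat :=
  fderiv ℝ (fun μ : CotangentSL q => mat (expSL q μ)) ℓ

/-- The conjugate covectors at `q`: the covectors at which the differential of the exponential
map has a nontrivial kernel. -/
def Conj (q : SL(2, ℝ)) : Set (CotangentSL q) :=
  {ℓ | ℓ ∈ expDomain q ∧ ∃ v : CotangentSL q, v ≠ 0 ∧ dexpSL q ℓ v = 0}

end SubRiemannianSL2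

end

noncomputable section

namespace SubRiemannianSL2

/-! After left translation Hamilton's equations can be integrated. The covector coordinate along X₀
is constant and the other two rotate uniformly, so with `(a, b, c) = (-coord₀, coord₁, coord₂)` the
endpoint is `q exp(aX₀ + bX₁ + cX₂) exp(-aX₀)` (`exists_isNormalExtremal`, `mat_expSL`). The first
exponential equals `C κ + S κ (aX₀ + bX₁ + cX₂)`, where `κ = b² + c² - a²` and `C`, `S` are entire.

Computing the differential shows that a conjugate covector has `b = c = 0`, `S κ = 0` or `S' κ = 0`
(`conj_cases`). In the first case the whole line of covectors `(s, 0, 0)` is sent to `q`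
(`not_injOn_of_vertical`). If `S κ = 0` and `(b, c) ≠ 0`, the first exponential is scalar, and
rotating `(b, c)` moves the covector along a circle with a single image (`not_injOn_of_rotation`).

The case `S' κ = 0` is a fold (`not_injOn_of_fold`). Fix the symmetric traceless part of `flow 1 a b
c`. The determinant confines the two remaining matrix coordinates to a circle, and near the given
covector there is a curve of such covectors parametrised by `κ`. The angular speed on the circle is
a multiple of `S' κ` with a simple zero: `2κ S' = C - S`, and `C - S` has derivative `S/8 ≠ 0`
there. So the angle turns back and takes some value twice, arbitrarily close to the fold
(`exists_ne_eq_of_fold`). -/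

/-! ### The entire functions `C` and `S`. -/

theorem summable_mul_pow_of_le_inv_factorial {c : ℕ → ℝ} (hc : ∀ n, |c n| ≤ 1 / (n.factorial : ℝ))
    (y : ℝ) : Summable fun n => c n * y ^ n := by
  refine Summable.of_norm_bounded (Real.summable_pow_div_factorial |y|) fun n => ?_
  rw [Real.norm_eq_abs, abs_mul, abs_pow, div_eq_inv_mul, ← one_div]
  exact mul_le_mul_of_nonneg_right (hc n) (by positivity)

/-- Termwise differentiation on the ball of radius `|y| + 1`, dominated by the series `n / n! * r ^
(n - 1)`. -/
theorem hasDerivAt_tsum_mul_pow {c : ℕ → ℝ} (hc : ∀ n, |c n| ≤ 1 / (n.factorial : ℝ)) (y : ℝ) :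
    HasDerivAt (fun y => ∑' n, c n * y ^ n) (∑' n, ((n + 1 : ℕ) * c (n + 1)) * y ^ n) y := by
  set r : ℝ := |y| + 1
  have hr : 0 < r := by positivity
  let u : ℕ → ℝ := fun n => n / (n.factorial : ℝ) * r ^ (n - 1)
  have hu : Summable u := by
    rw [← summable_nat_add_iff 1]
    refine (Real.summable_pow_div_factorial r).congr fun n => ?_
    simp only [u, Nat.add_sub_cancel, Nat.factorial_succ]
    have : (n.factorial : ℝ) ≠ 0 := by positivity
    push_cast
    field_simp
  have h := hasDerivAt_tsum_of_isPreconnected (g := fun n y => c n * y ^ n)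
    (g' := fun n y => c n * (n * y ^ (n - 1))) (t := Metric.ball 0 r) (u := u) (y₀ := 0) (y := y)
    hu Metric.isOpen_ball (convex_ball 0 r).isPreconnected
    (fun n z _ => (hasDerivAt_pow n z).const_mul (c n))
    (fun n z hz => by
      have hz' : |z| ≤ r := by
        rw [← Real.norm_eq_abs]; exact (mem_ball_zero_iff.1 hz).le
      rw [Real.norm_eq_abs, abs_mul, abs_mul, abs_pow, Nat.abs_cast]
      calc |c n| * (n * |z| ^ (n - 1)) ≤ 1 / (n.factorial : ℝ) * (n * r ^ (n - 1)) := by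
            gcongr
            exact hc n
        _ = u n := by simp only [u]; ring)
    (Metric.mem_ball_self hr) (summable_mul_pow_of_le_inv_factorial hc 0)
    (by rw [mem_ball_zero_iff, Real.norm_eq_abs]; simp [r])
  refine h.congr_deriv ?_
  have hs : Summable fun n : ℕ => c n * (n * y ^ (n - 1)) := by
    refine Summable.of_norm_bounded hu fun n => ?_
    rw [Real.norm_eq_abs, abs_mul, abs_mul, abs_pow, Nat.abs_cast]
    calc |c n| * (n * |y| ^ (n - 1)) ≤ 1 / (n.factorial : ℝ) * (n * r ^ (n - 1)) := by
            gcongr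
            · exact hc n
            · simp [r]
        _ = u n := by simp only [u]; ring
  rw [hs.tsum_eq_zero_add]
  simp only [Nat.cast_zero, zero_mul, mul_zero, zero_add, Nat.add_sub_cancel]
  exact tsum_congr fun n => by ring

/-- The entire function `∑ yⁿ / (2 n + k)!`. -/
def evenExp (k : ℕ) (y : ℝ) : ℝ := ∑' n : ℕ, 1 / ((2 * n + k).factorial : ℝ) * y ^ n

theorem abs_inv_factorial_le (k n : ℕ) :
    |1 / ((2 * n + k).factorial : ℝ)| ≤ 1 / (n.factorial : ℝ) := by
  rw [abs_of_nonneg (by positivity)]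
  exact one_div_le_one_div_of_le (by positivity)
    (by exact_mod_cast Nat.factorial_le (by omega))

theorem summable_evenExp (k : ℕ) (y : ℝ) :
    Summable fun n : ℕ => 1 / ((2 * n + k).factorial : ℝ) * y ^ n :=
  summable_mul_pow_of_le_inv_factorial (abs_inv_factorial_le k) y

theorem evenExp_eq (k : ℕ) (y : ℝ) :
    evenExp k y = 1 / (k.factorial : ℝ) + y * evenExp (k + 2) y := by
  rw [evenExp, (summable_evenExp k y).tsum_eq_zero_add, evenExp, ← tsum_mul_left]
  congr 1
  · simp
  · refine tsum_congr fun n => ?_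
    rw [show 2 * (n + 1) + k = 2 * n + (k + 2) by ring]
    ring

theorem hasDerivAt_evenExp_zero (y : ℝ) :
    HasDerivAt (evenExp 0) (evenExp 1 y / 2) y := by
  refine (hasDerivAt_tsum_mul_pow (abs_inv_factorial_le 0) y).congr_deriv ?_
  rw [evenExp, div_eq_inv_mul, ← tsum_mul_left]
  refine tsum_congr fun n => ?_
  rw [show 2 * (n + 1) + 0 = (2 * n + 1) + 1 by ring, Nat.factorial_succ (2 * n + 1)]
  have : ((2 * n + 1).factorial : ℝ) ≠ 0 := by positivity
  have : (n : ℝ) + 1 ≠ 0 := by positivity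
  push_cast
  rw [show (2 * (n : ℝ) + 1 + 1) = 2 * (n + 1) by ring]
  field_simp

/-- Coefficientwise, `2(n+1) = (2n+3) - 1` splits `(n+1)/(2n+3)!` into half the difference of
`1/(2n+2)!` and `1/(2n+3)!`. -/
theorem hasDerivAt_evenExp_one (y : ℝ) :
    HasDerivAt (evenExp 1) ((evenExp 2 y - evenExp 3 y) / 2) y := by
  refine (hasDerivAt_tsum_mul_pow (abs_inv_factorial_le 1) y).congr_deriv ?_
  rw [evenExp, evenExp, ← (summable_evenExp 2 y).tsum_sub (summable_evenExp 3 y), div_eq_inv_mul,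
    ← tsum_mul_left]
  refine tsum_congr fun n => ?_
  rw [show 2 * (n + 1) + 1 = (2 * n + 2) + 1 by ring,
    show 2 * n + 3 = (2 * n + 2) + 1 by ring, Nat.factorial_succ (2 * n + 2)]
  have : ((2 * n + 2).factorial : ℝ) ≠ 0 := by positivity
  have : 2 * (n : ℝ) + 2 + 1 ≠ 0 := by positivity
  push_cast
  field_simp
  ring

theorem evenExp_three_lt_two {y : ℝ} (hy : 0 ≤ y) : evenExp 3 y < evenExp 2 y := by
  refine Summable.tsum_lt_tsum (i := 0) (fun n => ?_) ?_ (summable_evenExp 3 y)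
    (summable_evenExp 2 y)
  · have : (2 * n + 2).factorial ≤ (2 * n + 3).factorial := Nat.factorial_le (by omega)
    refine mul_le_mul_of_nonneg_right ?_ (by positivity)
    exact one_div_le_one_div_of_le (by positivity) (by exact_mod_cast this)
  · norm_num [Nat.factorial]

/-- The function `κ ↦ cosh (√κ / 2)`, extended to an entire function. -/
def C (κ : ℝ) : ℝ := evenExp 0 (κ / 4)

/-- The function `κ ↦ sinh (√κ / 2) / (√κ / 2)`, extended to an entire function. -/
def S (κ : ℝ) : ℝ := evenExp 1 (κ / 4)

/-- The derivative of `S`. -/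
def S' (κ : ℝ) : ℝ := (evenExp 2 (κ / 4) - evenExp 3 (κ / 4)) / 8

theorem hasDerivAt_C (κ : ℝ) : HasDerivAt C (S κ / 8) κ := by
  refine ((hasDerivAt_evenExp_zero (κ / 4)).comp κ ((hasDerivAt_id κ).div_const 4)).congr_deriv ?_
  simp only [S]; ring

theorem hasDerivAt_S (κ : ℝ) : HasDerivAt S (S' κ) κ := by
  refine ((hasDerivAt_evenExp_one (κ / 4)).comp κ ((hasDerivAt_id κ).div_const 4)).congr_deriv ?_
  simp only [S']; ring

/-- Exchanges a zero of `S'` for one of `C - S`, whose derivative is known without a second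
derivative of `S`. -/
theorem two_mul_mul_S' (κ : ℝ) : 2 * κ * S' κ = C κ - S κ := by
  rw [C, S, S', evenExp_eq 0, evenExp_eq 1]
  norm_num
  ring

theorem C_zero : C 0 = 1 := by simp [C, evenExp_eq 0]

/-- This is `cosh² - sinh² = 1`, continued to all real `κ`: the left side has zero derivative. -/
theorem C_sq_sub (κ : ℝ) : C κ ^ 2 - κ * S κ ^ 2 / 4 = 1 := by
  have h : ∀ x, HasDerivAt (fun x => C x ^ 2 - x * S x ^ 2 / 4) 0 x := fun x => by
    refine (((hasDerivAt_C x).pow 2).sub (((hasDerivAt_id x).mul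
      ((hasDerivAt_S x).pow 2)).div_const 4)).congr_deriv ?_
    simp only [id, Pi.pow_apply]
    linear_combination (-S x / 4) * two_mul_mul_S' x
  have := is_const_of_deriv_eq_zero (fun x => (h x).differentiableAt) (fun x => (h x).deriv) κ 0
  simpa [C_zero] using this

/-- Hence every zero of `S'` is at a negative `κ`. -/
theorem S'_pos {κ : ℝ} (h : 0 ≤ κ) : 0 < S' κ := by
  have := evenExp_three_lt_two (y := κ / 4) (by positivity)
  rw [S']; linarith

/-- A common zero of `S` and `S'` would also be a zero of `C`, against `C_sq_sub`. -/
theorem S_ne_zero_of_S' {κ : ℝ} (h : S' κ = 0) : S κ ≠ 0 := by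
  intro hS
  have h1 := two_mul_mul_S' κ
  have h2 := C_sq_sub κ
  rw [h, hS] at h1
  rw [hS, show C κ = 0 by linarith] at h2
  norm_num at h2

/-! ### Matrix algebra and derivatives of matrix curves. -/

theorem mul_apply (A B : Mat) (i j : Fin 2) : mul A B i j = A i 0 * B 0 j + A i 1 * B 1 j := by
  simp [mul, Matrix.mul_apply, Fin.sum_univ_two]

theorem mul_assoc' (A B D : Mat) : mul (mul A B) D = mul A (mul B D) := by
  ext i j; simp only [mul_apply]; ring

theorem det_eq (A : Mat) : det A = A 0 0 * A 1 1 - A 0 1 * A 1 0 := Matrix.det_fin_two _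

theorem mat_ext {A B : Mat} (h00 : A 0 0 = B 0 0) (h01 : A 0 1 = B 0 1) (h10 : A 1 0 = B 1 0)
    (h11 : A 1 1 = B 1 1) : A = B := by
  ext i j; fin_cases i <;> fin_cases j <;> assumption

/-- The identity matrix. -/
def one : Mat := ![![1, 0], ![0, 1]]

/-- The adjugate of a matrix. -/
def adj (A : Mat) : Mat := ![![A 1 1, -A 0 1], ![-A 1 0, A 0 0]]

theorem mul_one' (A : Mat) : mul A one = A := by
  apply mat_ext <;> simp [mul_apply, one]

theorem one_mul' (A : Mat) : mul one A = A := by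
  apply mat_ext <;> simp [mul_apply, one]

theorem mul_adj {A : Mat} (h : det A = 1) : mul A (adj A) = one := by
  rw [det_eq] at h
  apply mat_ext <;> simp [mul_apply, one, adj] <;> linarith

theorem adj_mul {A : Mat} (h : det A = 1) : mul (adj A) A = one := by
  rw [det_eq] at h
  apply mat_ext <;> simp [mul_apply, one, adj] <;> linarith

theorem mul_left_cancel' {A B D : Mat} (h : det A = 1) (hBD : mul A B = mul A D) : B = D := by
  rw [← one_mul' B, ← one_mul' D, ← adj_mul h, mul_assoc', mul_assoc', hBD]

theorem det_mul' (A B : Mat) : det (mul A B) = det A * det B := by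
  simp only [det_eq, mul_apply]; ring

theorem hasDerivWithinAt_mat {f : ℝ → Mat} {f' : Mat} {s : Set ℝ} {t : ℝ} :
    HasDerivWithinAt f f' s t ↔
      ∀ i j, HasDerivWithinAt (fun x => f x i j) (f' i j) s t := by
  rw [hasDerivWithinAt_pi]
  exact forall_congr' fun i => hasDerivWithinAt_pi

theorem hasDerivAt_mat {f : ℝ → Mat} {f' : Mat} {t : ℝ} :
    HasDerivAt f f' t ↔ ∀ i j, HasDerivAt (fun x => f x i j) (f' i j) t := by
  simp only [← hasDerivWithinAt_univ]
  exact hasDerivWithinAt_mat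

theorem hasDerivWithinAt_mul {f g : ℝ → Mat} {f' g' : Mat} {s : Set ℝ} {t : ℝ}
    (hf : HasDerivWithinAt f f' s t) (hg : HasDerivWithinAt g g' s t) :
    HasDerivWithinAt (fun x => mul (f x) (g x)) (mul f' (g t) + mul (f t) g') s t := by
  rw [hasDerivWithinAt_mat] at *
  intro i j
  simp only [mul_apply, Pi.add_apply]
  exact (((hf i 0).mul (hg 0 j)).add ((hf i 1).mul (hg 1 j))).congr_deriv (by ring)

theorem hasDerivAt_mul {f g : ℝ → Mat} {f' g' : Mat} {t : ℝ}
    (hf : HasDerivAt f f' t) (hg : HasDerivAt g g' t) :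
    HasDerivAt (fun x => mul (f x) (g x)) (mul f' (g t) + mul (f t) g') t := by
  simp only [← hasDerivWithinAt_univ] at *
  exact hasDerivWithinAt_mul hf hg

theorem hasDerivAt_adj {f : ℝ → Mat} {f' : Mat} {t : ℝ} (hf : HasDerivAt f f' t) :
    HasDerivAt (fun x => adj (f x)) (adj f') t := by
  rw [hasDerivAt_mat] at *
  intro i j
  fin_cases i <;> fin_cases j
  exacts [hf 1 1, (hf 0 1).neg, (hf 1 0).neg, hf 0 0]

/-! ### The explicit horizontal curve `flow`. -/

/-- Four times the negative of the determinant of `gen a b c`. -/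
def disc (a b c : ℝ) : ℝ := b ^ 2 + c ^ 2 - a ^ 2

/-- The matrix `a X₀ + b X₁ + c X₂`. -/
def gen (a b c : ℝ) : Mat := ![![b / 2, (c - a) / 2], ![(c + a) / 2, -b / 2]]

/-- The one-parameter group `exp (t (a X₀ + b X₁ + c X₂))`. -/
def expGen (t a b c : ℝ) : Mat :=
  ![![C (t ^ 2 * disc a b c) + t * S (t ^ 2 * disc a b c) * (b / 2),
      t * S (t ^ 2 * disc a b c) * ((c - a) / 2)],
    ![t * S (t ^ 2 * disc a b c) * ((c + a) / 2),
      C (t ^ 2 * disc a b c) - t * S (t ^ 2 * disc a b c) * (b / 2)]]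

/-- The rotation `exp (θ X₀)`. -/
def rot (θ : ℝ) : Mat :=
  ![![Real.cos (θ / 2), -Real.sin (θ / 2)], ![Real.sin (θ / 2), Real.cos (θ / 2)]]

/-- The curve `exp (t (a X₀ + b X₁ + c X₂)) exp (- t a X₀)`. -/
def flow (t a b c : ℝ) : Mat := mul (expGen t a b c) (rot (-(t * a)))

/-- The first coordinate of the control of `flow`. -/
def ctrl₁ (t a b c : ℝ) : ℝ := b * Real.cos (t * a) - c * Real.sin (t * a)

/-- The second coordinate of the control of `flow`. -/
def ctrl₂ (t a b c : ℝ) : ℝ := b * Real.sin (t * a) + c * Real.cos (t * a)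

/-- Since `gen a b c` squares to `disc / 4` times the identity, it suffices that `C(t² disc)` has
derivative `disc / 4` times `t S(t² disc)`, and the latter has derivative `C(t² disc)`. -/
theorem hasDerivAt_expGen (t a b c : ℝ) :
    HasDerivAt (fun t => expGen t a b c) (mul (expGen t a b c) (gen a b c)) t := by
  have hk : HasDerivAt (fun t : ℝ => t ^ 2 * disc a b c) (2 * t * disc a b c) t :=
    ((hasDerivAt_pow 2 t).mul_const _).congr_deriv (by norm_num)
  have hC : HasDerivAt (fun t : ℝ => C (t ^ 2 * disc a b c))
      (t * S (t ^ 2 * disc a b c) * (disc a b c / 4)) t :=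
    ((hasDerivAt_C _).comp t hk).congr_deriv (by ring)
  have hS : HasDerivAt (fun t : ℝ => t * S (t ^ 2 * disc a b c)) (C (t ^ 2 * disc a b c)) t :=
    ((hasDerivAt_id t).mul ((hasDerivAt_S _).comp t hk)).congr_deriv (by
      simp only [id, Function.comp_apply]
      linear_combination two_mul_mul_S' (t ^ 2 * disc a b c))
  rw [hasDerivAt_mat]
  intro i j
  fin_cases i <;> fin_cases j
  · refine (hC.add (hS.mul_const (b / 2))).congr_deriv ?_
    simp [mul_apply, expGen, gen]; simp only [disc]; ring
  · refine (hS.mul_const ((c - a) / 2)).congr_deriv ?_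
    simp [mul_apply, expGen, gen]; ring
  · refine (hS.mul_const ((c + a) / 2)).congr_deriv ?_
    simp [mul_apply, expGen, gen]; ring
  · refine (hC.sub (hS.mul_const (b / 2))).congr_deriv ?_
    simp [mul_apply, expGen, gen]; simp only [disc]; ring

theorem hasDerivAt_rot (t a : ℝ) :
    HasDerivAt (fun t => rot (-(t * a))) (mul (gen (-a) 0 0) (rot (-(t * a)))) t := by
  have hk : HasDerivAt (fun t : ℝ => -(t * a) / 2) (-a / 2) t :=
    (((hasDerivAt_id t).mul_const a).neg.div_const 2).congr_deriv (by simp)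
  have hc := (Real.hasDerivAt_cos _).comp t hk
  have hs := (Real.hasDerivAt_sin _).comp t hk
  rw [hasDerivAt_mat]
  intro i j
  fin_cases i <;> fin_cases j
  · refine hc.congr_deriv ?_
    simp [mul_apply, rot, gen]; ring
  · refine hs.neg.congr_deriv ?_
    simp [mul_apply, rot, gen]; ring
  · refine hs.congr_deriv ?_
    simp [mul_apply, rot, gen]; ring
  · refine hc.congr_deriv ?_
    simp [mul_apply, rot, gen]; ring

/-- Conjugation by a rotation turns the plane of X₁ and X₂ through twice the matrix angle, hence the
half-angles in `rot`. -/
theorem gen_mul_rot (t a b c : ℝ) :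
    mul (gen 0 b c) (rot (-(t * a))) =
      mul (rot (-(t * a))) (gen 0 (ctrl₁ t a b c) (ctrl₂ t a b c)) := by
  have h1 := Real.cos_two_mul (t * a / 2)
  have h2 := Real.sin_two_mul (t * a / 2)
  have h3 := Real.sin_sq_add_cos_sq (t * a / 2)
  rw [show 2 * (t * a / 2) = t * a by ring] at h1 h2
  have h4 : -(t * a) / 2 = -(t * a / 2) := by ring
  apply mat_ext <;>
    simp only [mul_apply, rot, gen, ctrl₁, ctrl₂, h1, h2, h4, Real.cos_neg, Real.sin_neg,
      Matrix.cons_val_zero, Matrix.cons_val_one] <;>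
    generalize Real.cos (t * a / 2) = x at * <;> generalize Real.sin (t * a / 2) = y at *
  · linear_combination (-b * x) * h3
  · linear_combination (-c * x) * h3
  · linear_combination (-c * x) * h3
  · linear_combination (b * x) * h3

/-- The two factors contribute `aX₀` and `-aX₀` in the middle; these cancel, so the velocity is
horizontal. -/
theorem hasDerivAt_flow (t a b c : ℝ) :
    HasDerivAt (fun t => flow t a b c)
      (mul (flow t a b c) (gen 0 (ctrl₁ t a b c) (ctrl₂ t a b c))) t := by
  refine (hasDerivAt_mul (hasDerivAt_expGen t a b c) (hasDerivAt_rot t a)).congr_deriv ?_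
  rw [flow, mul_assoc', mul_assoc', ← gen_mul_rot]
  apply mat_ext <;> simp only [mul_apply, gen, Pi.add_apply,
      Matrix.cons_val_zero, Matrix.cons_val_one] <;> ring

theorem det_flow (t a b c : ℝ) : det (flow t a b c) = 1 := by
  have h1 : det (expGen t a b c) = 1 := by
    have h := C_sq_sub (t ^ 2 * disc a b c)
    have hK : t ^ 2 * disc a b c = t ^ 2 * (b ^ 2 + c ^ 2 - a ^ 2) := rfl
    simp only [det_eq, expGen, Matrix.cons_val_zero, Matrix.cons_val_one]
    generalize t ^ 2 * disc a b c = K at *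
    linear_combination h + S K ^ 2 / 4 * hK
  have h2 : det (rot (-(t * a))) = 1 := by
    simp [det_eq, rot]
    linarith [Real.sin_sq_add_cos_sq (-(t * a) / 2)]
  rw [flow, det_mul', h1, h2, mul_one]

theorem flow_zero (a b c : ℝ) : flow 0 a b c = one := by
  apply mat_ext <;> simp [flow, mul_apply, expGen, rot, one, C_zero]

theorem hasDerivAt_adj_flow (t a b c : ℝ) :
    HasDerivAt (fun t => adj (flow t a b c))
      (-mul (gen 0 (ctrl₁ t a b c) (ctrl₂ t a b c)) (adj (flow t a b c))) t := by
  refine (hasDerivAt_adj (hasDerivAt_flow t a b c)).congr_deriv ?_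
  apply mat_ext <;> simp only [mul_apply, adj, gen, Pi.neg_apply,
      Matrix.cons_val_zero, Matrix.cons_val_one] <;> ring

/-! ### The Hamiltonian vector field. -/

theorem traceForm_apply (M A : Mat) :
    traceForm M A = M 1 1 * A 0 0 - M 0 1 * A 1 0 - M 1 0 * A 0 1 + M 0 0 * A 1 1 := by
  simp [traceForm, Matrix.adjugate_fin_two, Matrix.trace_fin_two, Matrix.vecHead, Matrix.vecTail]
  ring

theorem traceForm_self {M : Mat} (h : det M = 1) : traceForm M M = 2 := by
  rw [det_eq] at h
  rw [traceForm_apply]; linarith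

theorem traceForm_mul {M : Mat} (h : det M = 1) (A : Mat) :
    traceForm M (mul M A) = A 0 0 + A 1 1 := by
  rw [det_eq] at h
  simp only [traceForm_apply, mul_apply]
  linear_combination (A 0 0 + A 1 1) * h

theorem traceForm_mul_gen {M : Mat} (h : det M = 1) (a b c : ℝ) :
    traceForm M (mul M (gen a b c)) = 0 := by
  rw [traceForm_mul h]; simp [gen]; ring

theorem X₀_eq : X₀ = gen 1 0 0 := by apply mat_ext <;> norm_num [X₀, gen]

theorem X₁_eq : X₁ = gen 0 1 0 := by apply mat_ext <;> norm_num [X₁, gen]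

theorem X₂_eq : X₂ = gen 0 0 1 := by apply mat_ext <;> simp [X₂, gen]

/-- Right multiplication by a matrix. -/
def mulRight (W : Mat) : Mat →L[ℝ] Mat :=
  LinearMap.toContinuousLinearMap
    { toFun := fun A => mul A W
      map_add' := fun A B => by ext i j; simp only [mul_apply, Pi.add_apply]; ring
      map_smul' := fun r A => by
        ext i j; simp only [mul_apply, Pi.smul_apply, smul_eq_mul, RingHom.id_apply]; ring }

@[simp] theorem mulRight_apply (W A : Mat) : mulRight W A = mul A W := rfl

/-- The linear form `A ↦ p (A W)` as a function of `W`. -/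
def dualMul (p : StrongDual ℝ Mat) : Mat →L[ℝ] StrongDual ℝ Mat :=
  LinearMap.toContinuousLinearMap
    { toFun := fun W => p.comp (mulRight W)
      map_add' := fun W W' => by
        ext A
        simp only [ContinuousLinearMap.comp_apply, mulRight_apply, add_apply,
          ← map_add]
        congr 1
        ext i j; simp only [mul_apply, Pi.add_apply]; ring
      map_smul' := fun r W => by
        ext A
        simp only [ContinuousLinearMap.comp_apply, mulRight_apply, smul_apply,
          ← map_smul, RingHom.id_apply]
        congr 1
        ext i j; simp only [mul_apply, Pi.smul_apply, smul_eq_mul]; ring }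

@[simp] theorem dualMul_apply (p : StrongDual ℝ Mat) (W A : Mat) :
    dualMul p W A = p (mul A W) := rfl

theorem mul_gen (A : Mat) (a b c : ℝ) :
    mul A (gen a b c) = a • mul A X₀ + b • mul A X₁ + c • mul A X₂ := by
  rw [X₀_eq, X₁_eq, X₂_eq]
  apply mat_ext <;>
    simp only [mul_apply, gen, Pi.add_apply, Pi.smul_apply, smul_eq_mul,
      Matrix.cons_val_zero, Matrix.cons_val_one] <;> ring

theorem map_mul_gen (p : StrongDual ℝ Mat) (A : Mat) (a b c : ℝ) :
    p (mul A (gen a b c)) = a * p (mul A X₀) + b * p (mul A X₁) + c * p (mul A X₂) := by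
  rw [mul_gen, map_add, map_add, map_smul, map_smul, map_smul]
  rfl

/-- The control of the normal extremal through `z`. -/
def control (z : AmbientCotangent) : Mat := gen 0 (z.2 (mul z.1 X₁)) (z.2 (mul z.1 X₂))

theorem fderiv_hamiltonian (z η : AmbientCotangent) :
    fderiv ℝ hamiltonian z η = η.2 (mul z.1 (control z)) + z.2 (mul η.1 (control z)) := by
  have h : ∀ X : Mat, HasFDerivAt (fun y : AmbientCotangent => y.2 (mul y.1 X)) _ z := fun X =>
    (hasFDerivAt_snd (𝕜 := ℝ) (p := z)).clm_apply
      ((mulRight X).hasFDerivAt.comp z (hasFDerivAt_fst (𝕜 := ℝ) (p := z)))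
  have h' := (((h X₁).pow 2).add ((h X₂).pow 2)).const_mul (1 / 2)
  have : HasFDerivAt hamiltonian _ z := h'
  rw [this.fderiv]
  simp [control, map_mul_gen]
  ring

/-- The Hamiltonian vector of the ambient form `dp ∧ dq` is already tangent: right translation of
`q` and the dual motion of `p` preserve `p q`. -/
theorem isHamiltonianVector_control {z : AmbientCotangent} (hz : z ∈ CotangentBundleSL) :
    IsHamiltonianVector hamiltonian z (mul z.1 (control z), -dualMul z.2 (control z)) := by
  refine ⟨⟨traceForm_mul_gen hz.1 _ _ _, ?_⟩, fun η _ => ?_⟩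
  · simp
  · rw [fderiv_hamiltonian]
    simp [sympl]

/-- Each matrix entry, corrected by a multiple of `traceForm M` so as to vanish at `M`, is an
admissible test form. -/
theorem eq_zero_of_dual {M D : Mat} (hM : det M = 1) (hD : traceForm M D = 0)
    (h : ∀ α : StrongDual ℝ Mat, α M = 0 → α D = 0) : D = 0 := by
  ext i j
  have := h ((ContinuousLinearMap.proj (R := ℝ) (φ := fun _ : Fin 2 => ℝ) j).comp
        (ContinuousLinearMap.proj (R := ℝ) (φ := fun _ : Fin 2 => Fin 2 → ℝ) i) -
      (M i j / 2) • LinearMap.toContinuousLinearMap (traceForm M))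
    (by simp [traceForm_self hM])
  simpa [hD] using this

theorem IsHamiltonianVector.fst_eq {z ξ : AmbientCotangent} (hz : z ∈ CotangentBundleSL)
    (h : IsHamiltonianVector hamiltonian z ξ) : ξ.1 = mul z.1 (control z) := by
  rw [← sub_eq_zero]
  refine eq_zero_of_dual hz.1 ?_ fun α hα => ?_
  · rw [map_sub, h.1.1, control, traceForm_mul_gen hz.1, sub_zero]
  · have := h.2 (0, α) ⟨by simp, by simpa using hα⟩
    rw [fderiv_hamiltonian] at this
    have h0 : mul (0 : Mat) (control z) = 0 := (mulRight (control z)).map_zero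
    simp only [sympl, h0, map_zero, sub_zero, add_zero] at this
    rw [map_sub, this, sub_self]

/-- The test vector `(A, β)` is made tangent by taking `β` a multiple of the trace form, which
vanishes on the velocities and so drops out. -/
theorem IsHamiltonianVector.snd_apply {z ξ : AmbientCotangent} (hz : z ∈ CotangentBundleSL)
    (h : IsHamiltonianVector hamiltonian z ξ) {A : Mat} (hA : traceForm z.1 A = 0) :
    ξ.2 A = -z.2 (mul A (control z)) := by
  have := h.2 (A, (-z.2 A / 2) • LinearMap.toContinuousLinearMap (traceForm z.1))
    ⟨hA, by simp [traceForm_self hz.1]⟩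
  rw [fderiv_hamiltonian] at this
  have h1 : traceForm z.1 ξ.1 = 0 := h.1.1
  have h2 : traceForm z.1 (mul z.1 (control z)) = 0 := traceForm_mul_gen hz.1 _ _ _
  simp [sympl, h1, h2] at this
  linarith

/-! ### Integrating the extremals. -/

/-- The value of a left-invariant vector field at `q`. -/
def leftInv (q : SL(2, ℝ)) (a b c : ℝ) : TangentSL q :=
  ⟨mul (mat q) (gen a b c), traceForm_mul_gen q.2 a b c⟩

/-- The coordinates of a covector in the left-invariant frame. -/
def coord₀ (q : SL(2, ℝ)) (ℓ : CotangentSL q) : ℝ := ℓ (leftInv q 1 0 0)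

/-- See `coord₀`. -/
def coord₁ (q : SL(2, ℝ)) (ℓ : CotangentSL q) : ℝ := ℓ (leftInv q 0 1 0)

/-- See `coord₀`. -/
def coord₂ (q : SL(2, ℝ)) (ℓ : CotangentSL q) : ℝ := ℓ (leftInv q 0 0 1)

theorem eq_of_hasDerivWithinAt_zero {E : Type*} [NormedAddCommGroup E] [NormedSpace ℝ E]
    {f : ℝ → E} (h : ∀ t ∈ Set.Icc (0 : ℝ) 1, HasDerivWithinAt f 0 (Set.Icc 0 1) t) {t : ℝ}
    (ht : t ∈ Set.Icc (0 : ℝ) 1) : f t = f 0 := by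
  refine constant_of_derivWithin_zero (fun s hs => (h s hs).differentiableWithinAt)
    (fun s hs => ?_) t ht
  have hs' : s ∈ Set.Icc (0 : ℝ) 1 := ⟨hs.1, hs.2.le⟩
  exact (h s hs').derivWithin (uniqueDiffOn_Icc zero_lt_one s hs')

theorem det_mat (q : SL(2, ℝ)) : det (mat q) = 1 := q.2

section

variable {q : SL(2, ℝ)} {ℓ : CotangentSL q} {z : ℝ → AmbientCotangent}

theorem IsNormalExtremal.hasDerivWithinAt_fst (hz : IsNormalExtremal q ℓ z) {t : ℝ}
    (ht : t ∈ Set.Icc (0 : ℝ) 1) :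
    HasDerivWithinAt (fun s => (z s).1) (mul (z t).1 (control (z t))) (Set.Icc 0 1) t := by
  obtain ⟨ξ, hξ, hd⟩ := hz.deriv t ht
  rw [← hξ.fst_eq (hz.mem t ht)]
  exact (ContinuousLinearMap.fst ℝ Mat (StrongDual ℝ Mat)).hasFDerivAt.comp_hasDerivWithinAt t hd

theorem IsNormalExtremal.hasDerivWithinAt_coord (hz : IsNormalExtremal q ℓ z) {t : ℝ}
    (ht : t ∈ Set.Icc (0 : ℝ) 1) (a b c : ℝ) :
    HasDerivWithinAt (fun s => (z s).2 (mul (z s).1 (gen a b c)))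
      ((z t).2 (mul (z t).1 (mul (control (z t)) (gen a b c) - mul (gen a b c) (control (z t)))))
      (Set.Icc 0 1) t := by
  obtain ⟨ξ, hξ, hd⟩ := hz.deriv t ht
  have h2 : HasDerivWithinAt (fun s => (z s).2) ξ.2 (Set.Icc 0 1) t :=
    (ContinuousLinearMap.snd ℝ Mat (StrongDual ℝ Mat)).hasFDerivAt.comp_hasDerivWithinAt t hd
  have h1 := (mulRight (gen a b c)).hasFDerivAt.comp_hasDerivWithinAt t (hz.hasDerivWithinAt_fst ht)
  refine (h2.clm_apply h1).congr_deriv ?_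
  have hA := hξ.snd_apply (hz.mem t ht) (traceForm_mul_gen (hz.mem t ht).1 a b c)
  simp only [Function.comp_apply, mulRight_apply]
  rw [hA, mul_assoc', mul_assoc', neg_add_eq_sub, ← map_sub]
  congr 1
  ext i j; simp only [mul_apply, Pi.sub_apply]; ring

theorem bracket_gen (a b c b' c' : ℝ) :
    mul (gen 0 b' c') (gen a b c) - mul (gen a b c) (gen 0 b' c') =
      gen (b * c' - b' * c) (a * c') (-(a * b')) := by
  apply mat_ext <;>
    simp only [mul_apply, gen, Pi.sub_apply, Matrix.cons_val_zero, Matrix.cons_val_one] <;> ring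

/-- The brackets make the X₀-coordinate constant and the pair of the other two rotate with that
constant speed; rotating back gives constants. -/
theorem IsNormalExtremal.coord_eq (hz : IsNormalExtremal q ℓ z) {t : ℝ}
    (ht : t ∈ Set.Icc (0 : ℝ) 1) :
    control (z t) = gen 0 (ctrl₁ t (-coord₀ q ℓ) (coord₁ q ℓ) (coord₂ q ℓ))
      (ctrl₂ t (-coord₀ q ℓ) (coord₁ q ℓ) (coord₂ q ℓ)) := by
  have hstart : ∀ a b c, (z 0).2 (mul (z 0).1 (gen a b c)) = ℓ (leftInv q a b c) := fun a b c => by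
    rw [hz.start_base]; exact hz.start_covector (leftInv q a b c)
  let f : ℝ → ℝ → ℝ → ℝ → ℝ := fun a b c t => (z t).2 (mul (z t).1 (gen a b c))
  have hu : ∀ t, control (z t) = gen 0 (f 0 1 0 t) (f 0 0 1 t) := fun t => by
    simp only [control, f, X₁_eq, X₂_eq]
  have hlin : ∀ a b c t, f a b c t = a * f 1 0 0 t + b * f 0 1 0 t + c * f 0 0 1 t := by
    intro a b c t
    simp only [f]
    rw [map_mul_gen, X₀_eq, X₁_eq, X₂_eq]
  have hd : ∀ t ∈ Set.Icc (0 : ℝ) 1, ∀ a b c, HasDerivWithinAt (f a b c)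
      (f (b * f 0 0 1 t - f 0 1 0 t * c) (a * f 0 0 1 t) (-(a * f 0 1 0 t)) t)
      (Set.Icc 0 1) t := by
    intro t ht a b c
    have := hz.hasDerivWithinAt_coord ht a b c
    rwa [hu, bracket_gen] at this
  have h0 : ∀ t ∈ Set.Icc (0 : ℝ) 1, f 1 0 0 t = coord₀ q ℓ := by
    intro t ht
    rw [eq_of_hasDerivWithinAt_zero (f := f 1 0 0) (fun s hs => ?_) ht]
    · exact hstart 1 0 0
    · refine (hd s hs 1 0 0).congr_deriv ?_
      rw [hlin]; ring
  have hd1 : ∀ t ∈ Set.Icc (0 : ℝ) 1, HasDerivWithinAt (f 0 1 0) (coord₀ q ℓ * f 0 0 1 t)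
      (Set.Icc 0 1) t := fun t ht => (hd t ht 0 1 0).congr_deriv (by
    rw [hlin, h0 t ht]; ring)
  have hd2 : ∀ t ∈ Set.Icc (0 : ℝ) 1, HasDerivWithinAt (f 0 0 1) (-(coord₀ q ℓ * f 0 1 0 t))
      (Set.Icc 0 1) t := fun t ht => (hd t ht 0 0 1).congr_deriv (by
    rw [hlin, h0 t ht]; ring)
  have hk : ∀ t : ℝ, HasDerivAt (fun t : ℝ => t * -coord₀ q ℓ) (-coord₀ q ℓ) t := fun t =>
    ((hasDerivAt_id t).mul_const _).congr_deriv (by simp)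
  have hc := fun t : ℝ => ((Real.hasDerivAt_cos _).comp t (hk t)).hasDerivWithinAt
    (s := Set.Icc 0 1)
  have hs := fun t : ℝ => ((Real.hasDerivAt_sin _).comp t (hk t)).hasDerivWithinAt
    (s := Set.Icc 0 1)
  have e1 := eq_of_hasDerivWithinAt_zero (fun t ht =>
    (((hd1 t ht).mul (hc t)).add ((hd2 t ht).mul (hs t))).congr_deriv (by
      simp only [Function.comp_apply]; ring)) ht
  have e2 := eq_of_hasDerivWithinAt_zero (fun t ht =>
    (((hd2 t ht).mul (hc t)).sub ((hd1 t ht).mul (hs t))).congr_deriv (by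
      simp only [Function.comp_apply]; ring)) ht
  have s1 : f 0 1 0 0 = coord₁ q ℓ := hstart 0 1 0
  have s2 : f 0 0 1 0 = coord₂ q ℓ := hstart 0 0 1
  simp [s1, s2] at e1 e2
  have h3 := Real.sin_sq_add_cos_sq (t * coord₀ q ℓ)
  rw [hu]
  congr 1
  · simp only [ctrl₁, mul_neg, Real.cos_neg, Real.sin_neg]
    linear_combination -f 0 1 0 t * h3 + Real.cos (t * coord₀ q ℓ) * e1 +
      Real.sin (t * coord₀ q ℓ) * e2
  · simp only [ctrl₂, mul_neg, Real.cos_neg, Real.sin_neg]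
    linear_combination -f 0 0 1 t * h3 - Real.sin (t * coord₀ q ℓ) * e1 +
      Real.cos (t * coord₀ q ℓ) * e2

/-- The base curve and `flow` solve the same left-invariant equation, so base curve times inverse
flow is constant. -/
theorem IsNormalExtremal.endpoint (hz : IsNormalExtremal q ℓ z) :
    (z 1).1 = mul (mat q) (flow 1 (-coord₀ q ℓ) (coord₁ q ℓ) (coord₂ q ℓ)) := by
  set V := fun t => flow t (-coord₀ q ℓ) (coord₁ q ℓ) (coord₂ q ℓ)
  have key : mul (z 1).1 (adj (V 1)) = mul (z 0).1 (adj (V 0)) := by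
    refine eq_of_hasDerivWithinAt_zero (f := fun t => mul (z t).1 (adj (V t))) (fun t ht => ?_)
      (Set.right_mem_Icc.2 zero_le_one)
    refine (hasDerivWithinAt_mul (hz.hasDerivWithinAt_fst ht)
      (hasDerivAt_adj_flow t _ _ _).hasDerivWithinAt).congr_deriv ?_
    rw [hz.coord_eq ht, mul_assoc']
    ext i j; simp only [mul_apply, Pi.add_apply, Pi.neg_apply, Pi.zero_apply]; ring
  have h0 : adj (V 0) = one := by
    simp only [V, flow_zero]
    apply mat_ext <;> simp [adj, one]
  rw [h0, mul_one', hz.start_base] at key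
  rw [← key, mul_assoc', adj_mul (det_flow _ _ _ _), mul_one']

end

theorem trace_mul_conj {E : Mat} (hE : det E = 1) {G : Mat} (h : mul E G = mul G E) (Y : Mat) :
    (mul G (mul E (mul Y (adj E)))) 0 0 + (mul G (mul E (mul Y (adj E)))) 1 1 =
      (mul G Y) 0 0 + (mul G Y) 1 1 := by
  rw [← mul_assoc', ← h, mul_assoc', ← mul_assoc' G]
  have cyc : ∀ A B : Mat, (mul A B) 0 0 + (mul A B) 1 1 = (mul B A) 0 0 + (mul B A) 1 1 := by
    intro A B; simp only [mul_apply]; ring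
  rw [cyc, mul_assoc', adj_mul hE, mul_one']

theorem expGen_commute (t a b c : ℝ) :
    mul (expGen t a b c) (gen a b c) = mul (gen a b c) (expGen t a b c) := by
  apply mat_ext <;>
    simp only [mul_apply, expGen, gen, Matrix.cons_val_zero, Matrix.cons_val_one] <;> ring

theorem adj_mul' (A B : Mat) : adj (mul A B) = mul (adj B) (adj A) := by
  apply mat_ext <;>
    simp only [mul_apply, adj, Matrix.cons_val_zero, Matrix.cons_val_one] <;> ring

theorem det_rot (θ : ℝ) : det (rot θ) = 1 := by
  simp only [det_eq, rot, Matrix.cons_val_zero, Matrix.cons_val_one]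
  linarith [Real.sin_sq_add_cos_sq (θ / 2)]

theorem det_expGen (t a b c : ℝ) : det (expGen t a b c) = 1 := by
  have := det_flow t a b c
  rwa [flow, det_mul', det_rot, _root_.mul_one] at this

/-- The factor `expGen` commutes with `gen a b c` and disappears from the trace; only the rotation
acts. -/
theorem coadjoint_flow (t a b c x y : ℝ) :
    2 * ((mul (gen a b c) (mul (flow t a b c) (mul (gen 0 x y) (adj (flow t a b c))))) 0 0 +
      (mul (gen a b c) (mul (flow t a b c) (mul (gen 0 x y) (adj (flow t a b c))))) 1 1) =
      x * ctrl₁ t a b c + y * ctrl₂ t a b c := by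
  rw [flow, adj_mul', mul_assoc', ← mul_assoc' (gen 0 x y), ← mul_assoc' (rot (-(t * a))),
    trace_mul_conj (det_expGen t a b c) (expGen_commute t a b c)]
  have h1 := Real.cos_two_mul (t * a / 2)
  have h2 := Real.sin_two_mul (t * a / 2)
  have h3 := Real.sin_sq_add_cos_sq (t * a / 2)
  rw [show 2 * (t * a / 2) = t * a by ring] at h1 h2
  have h4 : -(t * a) / 2 = -(t * a / 2) := by ring
  simp only [mul_apply, rot, gen, adj, ctrl₁, ctrl₂, h1, h2, h4, Real.cos_neg, Real.sin_neg,
      Matrix.cons_val_zero, Matrix.cons_val_one]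
  linear_combination -(x * b + y * c) * h3

/-- The form `2 tr(GY)` identifies covectors with traceless matrices. It is `-1` on X₀ and `+1` on
X₁, X₂, whence the sign of `coord₀`. -/
theorem map_mul_eq_trace {q : SL(2, ℝ)} {ℓ : CotangentSL q} {p : StrongDual ℝ Mat}
    (h0 : p (mat q) = 0) (h : ∀ A : TangentSL q, p A.1 = ℓ A) (Y : Mat) :
    p (mul (mat q) Y) =
      2 * ((mul (gen (-coord₀ q ℓ) (coord₁ q ℓ) (coord₂ q ℓ)) Y) 0 0 +
      (mul (gen (-coord₀ q ℓ) (coord₁ q ℓ) (coord₂ q ℓ)) Y) 1 1) := by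
  have e0 : p (mul (mat q) X₀) = coord₀ q ℓ := by rw [X₀_eq]; exact h (leftInv q 1 0 0)
  have e1 : p (mul (mat q) X₁) = coord₁ q ℓ := by rw [X₁_eq]; exact h (leftInv q 0 1 0)
  have e2 : p (mul (mat q) X₂) = coord₂ q ℓ := by rw [X₂_eq]; exact h (leftInv q 0 0 1)
  have hY : mul (mat q) Y = mul (mat q) (gen (Y 1 0 - Y 0 1) (Y 0 0 - Y 1 1) (Y 0 1 + Y 1 0)) +
      ((Y 0 0 + Y 1 1) / 2) • mat q := by
    apply mat_ext <;> simp only [mul_apply, gen, Pi.add_apply, Pi.smul_apply, smul_eq_mul,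
      Matrix.cons_val_zero, Matrix.cons_val_one] <;> ring
  rw [hY, map_add, map_smul, h0, map_mul_gen, e0, e1, e2]
  simp only [mul_apply, gen, Matrix.cons_val_zero, Matrix.cons_val_one, smul_zero]
  ring

theorem exists_isNormalExtremal (q : SL(2, ℝ)) (ℓ : CotangentSL q) :
    ∃ z, IsNormalExtremal q ℓ z := by
  obtain ⟨p, ⟨hp0, hp⟩, -⟩ := existsUnique_representative q ℓ
  let V := fun t => flow t (-coord₀ q ℓ) (coord₁ q ℓ) (coord₂ q ℓ)
  -- The covector is transported by the inverse of the flow, which keeps `p q = 0`.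
  let z : ℝ → AmbientCotangent := fun t => (mul (mat q) (V t), dualMul p (adj (V t)))
  have hV0 : V 0 = one := flow_zero _ _ _
  have hadj : adj one = one := by apply mat_ext <;> simp [adj, one]
  have hctrl : ∀ t x y, (z t).2 (mul (z t).1 (gen 0 x y)) =
      x * ctrl₁ t (-coord₀ q ℓ) (coord₁ q ℓ) (coord₂ q ℓ) +
      y * ctrl₂ t (-coord₀ q ℓ) (coord₁ q ℓ) (coord₂ q ℓ) := by
    intro t x y
    rw [← coadjoint_flow]
    simp only [z, dualMul_apply]
    rw [mul_assoc', mul_assoc', map_mul_eq_trace hp0 hp]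
  have hu : ∀ t, control (z t) = gen 0 (ctrl₁ t (-coord₀ q ℓ) (coord₁ q ℓ) (coord₂ q ℓ))
      (ctrl₂ t (-coord₀ q ℓ) (coord₁ q ℓ) (coord₂ q ℓ)) := by
    intro t
    rw [control, X₁_eq, X₂_eq, hctrl, hctrl]
    simp
  have hmem : ∀ t, z t ∈ CotangentBundleSL := by
    refine fun t => ⟨?_, ?_⟩
    · simp only [z]
      rw [det_mul', det_mat, det_flow, _root_.mul_one]
    · simp only [z, dualMul_apply]
      rw [mul_assoc', mul_adj (det_flow _ _ _ _), mul_one', hp0]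
  refine ⟨z, ?_, fun A => ?_, fun t _ => hmem t, fun t _ =>
    ⟨_, isHamiltonianVector_control (hmem t), HasDerivAt.hasDerivWithinAt ?_⟩⟩
  · simp [z, hV0, mul_one']
  · simp [z, hV0, hadj, mul_one', hp]
  · rw [hu]
    have hL : HasDerivAt (fun t => mul (mat q) (V t)) _ t :=
      hasDerivAt_mul (hasDerivAt_const t (mat q)) (hasDerivAt_flow t _ _ _)
    have hR := (dualMul p).hasFDerivAt.comp_hasDerivAt t (hasDerivAt_adj_flow t (-coord₀ q ℓ)
      (coord₁ q ℓ) (coord₂ q ℓ))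
    refine (hL.prodMk hR).congr_deriv (Prod.ext ?_ ?_)
    · simp only [z, V]
      rw [mul_assoc']
      ext i j; simp only [mul_apply, Pi.add_apply, Pi.zero_apply]; ring
    · simp only [z, V, map_neg]
      congr 1
      ext A
      simp only [dualMul_apply, mul_assoc']

/-! ### The exponential map in left-invariant coordinates. -/

theorem mat_expSL (q : SL(2, ℝ)) (ℓ : CotangentSL q) :
    mat (expSL q ℓ) = mul (mat q) (flow 1 (-coord₀ q ℓ) (coord₁ q ℓ) (coord₂ q ℓ)) := by
  have h := exists_isNormalExtremal q ℓ
  have he : expSL q ℓ = ⟨Matrix.of (h.choose 1).1, (h.choose_spec.mem 1 (by simp)).1⟩ := dif_pos h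
  rw [he, ← h.choose_spec.endpoint]
  rfl

theorem expSL_eq_iff (q : SL(2, ℝ)) (ℓ ℓ' : CotangentSL q) :
    expSL q ℓ = expSL q ℓ' ↔ flow 1 (-coord₀ q ℓ) (coord₁ q ℓ) (coord₂ q ℓ) =
      flow 1 (-coord₀ q ℓ') (coord₁ q ℓ') (coord₂ q ℓ') := by
  constructor
  · intro h
    have := congrArg mat h
    rw [mat_expSL, mat_expSL] at this
    exact mul_left_cancel' (det_mat q) this
  · intro h
    have : mat (expSL q ℓ) = mat (expSL q ℓ') := by rw [mat_expSL, mat_expSL, h]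
    exact Subtype.ext this

theorem flow_one_zero_zero (a : ℝ) : flow 1 a 0 0 = one := by
  rw [← flow_zero a 0 0]
  refine eq_of_hasDerivWithinAt_zero (f := fun t => flow t a 0 0)
    (fun t _ => ((hasDerivAt_flow t a 0 0).congr_deriv ?_).hasDerivWithinAt)
    (Set.right_mem_Icc.2 zero_le_one)
  apply mat_ext <;> simp [mul_apply, gen, ctrl₁, ctrl₂]

/-- The covector whose left-invariant coordinates are `-x.1`, `x.2.1` and `x.2.2`. -/
def covec (q : SL(2, ℝ)) : ℝ × ℝ × ℝ →ₗ[ℝ] CotangentSL q where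
  toFun x := LinearMap.toContinuousLinearMap
    { toFun := fun A => -x.1 * (mul (adj (mat q)) A.1 1 0 - mul (adj (mat q)) A.1 0 1) +
        x.2.1 * (mul (adj (mat q)) A.1 0 0 - mul (adj (mat q)) A.1 1 1) +
        x.2.2 * (mul (adj (mat q)) A.1 0 1 + mul (adj (mat q)) A.1 1 0)
      map_add' := fun A B => by
        simp only [mul_apply, Submodule.coe_add, Pi.add_apply]; ring
      map_smul' := fun r A => by
        simp only [mul_apply, Submodule.coe_smul, Pi.smul_apply, smul_eq_mul, RingHom.id_apply]
        ring }
  map_add' x y := by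
    ext A
    simp only [LinearMap.coe_toContinuousLinearMap', LinearMap.coe_mk, AddHom.coe_mk,
      add_apply, Prod.fst_add, Prod.snd_add]
    ring
  map_smul' r x := by
    ext A
    simp only [LinearMap.coe_toContinuousLinearMap', LinearMap.coe_mk, AddHom.coe_mk,
      smul_apply, Prod.smul_fst, Prod.smul_snd, smul_eq_mul, RingHom.id_apply]
    ring

theorem covec_apply (q : SL(2, ℝ)) (x : ℝ × ℝ × ℝ) (A : TangentSL q) :
    covec q x A = -x.1 * (mul (adj (mat q)) A.1 1 0 - mul (adj (mat q)) A.1 0 1) +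
        x.2.1 * (mul (adj (mat q)) A.1 0 0 - mul (adj (mat q)) A.1 1 1) +
        x.2.2 * (mul (adj (mat q)) A.1 0 1 + mul (adj (mat q)) A.1 1 0) := rfl

theorem covec_leftInv (q : SL(2, ℝ)) (x : ℝ × ℝ × ℝ) (a b c : ℝ) :
    covec q x (leftInv q a b c) = -x.1 * a + x.2.1 * b + x.2.2 * c := by
  rw [covec_apply]
  simp only [leftInv]
  rw [← mul_assoc', adj_mul (det_mat q), one_mul']
  simp only [gen, Matrix.cons_val_zero, Matrix.cons_val_one]
  ring

theorem eq_leftInv (q : SL(2, ℝ)) (A : TangentSL q) :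
    ∃ a b c : ℝ, A = a • leftInv q 1 0 0 + b • leftInv q 0 1 0 + c • leftInv q 0 0 1 := by
  set N := mul (adj (mat q)) A.1 with hN
  refine ⟨N 1 0 - N 0 1, N 0 0 - N 1 1, N 0 1 + N 1 0, Subtype.ext ?_⟩
  have hA : A.1 = mul (mat q) N := by rw [hN, ← mul_assoc', mul_adj (det_mat q), one_mul']
  have htr : N 0 0 + N 1 1 = 0 := by
    rw [← traceForm_mul (det_mat q), ← hA]; exact A.2
  rw [hA]
  have h11 : N 1 1 = -N 0 0 := by linarith
  apply mat_ext <;> simp [leftInv, mul_apply, gen, h11] <;> ring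

theorem cotangent_ext {q : SL(2, ℝ)} {ℓ ℓ' : CotangentSL q} (h0 : coord₀ q ℓ = coord₀ q ℓ')
    (h1 : coord₁ q ℓ = coord₁ q ℓ') (h2 : coord₂ q ℓ = coord₂ q ℓ') : ℓ = ℓ' := by
  ext A
  obtain ⟨a, b, c, rfl⟩ := eq_leftInv q A
  simp only [coord₀, coord₁, coord₂] at h0 h1 h2
  simp only [map_add, map_smul, h0, h1, h2]

theorem coord_covec (q : SL(2, ℝ)) (x : ℝ × ℝ × ℝ) :
    coord₀ q (covec q x) = -x.1 ∧ coord₁ q (covec q x) = x.2.1 ∧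
      coord₂ q (covec q x) = x.2.2 := by
  simp [coord₀, coord₁, coord₂, covec_leftInv]

theorem covec_coord (q : SL(2, ℝ)) (ℓ : CotangentSL q) :
    covec q (-coord₀ q ℓ, coord₁ q ℓ, coord₂ q ℓ) = ℓ := by
  obtain ⟨h0, h1, h2⟩ := coord_covec q (-coord₀ q ℓ, coord₁ q ℓ, coord₂ q ℓ)
  exact cotangent_ext (by rw [h0, neg_neg]) h1 h2

theorem expSL_covec_eq_iff (q : SL(2, ℝ)) (x y : ℝ × ℝ × ℝ) :
    expSL q (covec q x) = expSL q (covec q y) ↔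
      flow 1 x.1 x.2.1 x.2.2 = flow 1 y.1 y.2.1 y.2.2 := by
  obtain ⟨h0, h1, h2⟩ := coord_covec q x
  obtain ⟨k0, k1, k2⟩ := coord_covec q y
  rw [expSL_eq_iff, h0, h1, h2, k0, k1, k2, neg_neg, neg_neg]

theorem covec_injective (q : SL(2, ℝ)) : Function.Injective (covec q) := by
  intro x y h
  obtain ⟨h0, h1, h2⟩ := coord_covec q x
  obtain ⟨k0, k1, k2⟩ := coord_covec q y
  rw [h] at h0 h1 h2
  exact Prod.ext (by linarith) (Prod.ext (by linarith) (by linarith))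

/-! ### Collapsed lines and circles. -/

theorem not_injOn_of_curve {q : SL(2, ℝ)} {ℓ : CotangentSL q} {U : Set (CotangentSL q)}
    (hU : U ∈ 𝓝 ℓ) {γ : ℝ → ℝ × ℝ × ℝ} {s : ℝ} (hγ : ContinuousAt γ s)
    (hs : γ s = (-coord₀ q ℓ, coord₁ q ℓ, coord₂ q ℓ))
    (h : ∀ N ∈ 𝓝 s, ∃ x ∈ N, ∃ y ∈ N, γ x ≠ γ y ∧
      flow 1 (γ x).1 (γ x).2.1 (γ x).2.2 = flow 1 (γ y).1 (γ y).2.1 (γ y).2.2) :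
    ¬ Set.InjOn (expSL q) U := by
  intro hinj
  have hL : Continuous (covec q) :=
    LinearMap.continuous_of_finiteDimensional (F' := CotangentSL q) (covec q)
  have hc : ContinuousAt (fun t => covec q (γ t)) s :=
    ContinuousAt.comp (g := covec q) hL.continuousAt hγ
  have hN : (fun t => covec q (γ t)) ⁻¹' U ∈ 𝓝 s := by
    refine hc ?_
    simpa only [hs, covec_coord] using hU
  obtain ⟨x, hx, y, hy, hne, heq⟩ := h _ hN
  exact hne (covec_injective q (hinj hx hy ((expSL_covec_eq_iff q _ _).2 heq)))

theorem exists_mem_ne {s : ℝ} {N : Set ℝ} (hN : N ∈ 𝓝 s) : ∃ x ∈ N, x ≠ s := by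
  have : (𝓝[≠] s).NeBot := inferInstance
  obtain ⟨x, hx⟩ := this.nonempty_of_mem
    (Filter.inter_mem (mem_nhdsWithin_of_mem_nhds hN) self_mem_nhdsWithin)
  exact ⟨x, hx.1, hx.2⟩

theorem not_injOn_of_vertical {q : SL(2, ℝ)} {ℓ : CotangentSL q} (h1 : coord₁ q ℓ = 0)
    (h2 : coord₂ q ℓ = 0) {U : Set (CotangentSL q)} (hU : U ∈ 𝓝 ℓ) :
    ¬ Set.InjOn (expSL q) U := by
  refine not_injOn_of_curve hU (γ := fun s => (s, 0, 0)) (s := -coord₀ q ℓ) (by fun_prop)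
    (by rw [h1, h2]) fun N hN => ?_
  obtain ⟨x, hx, hne⟩ := exists_mem_ne hN
  refine ⟨x, hx, _, mem_of_mem_nhds hN, fun h => hne (congrArg Prod.fst h), ?_⟩
  simp only [flow_one_zero_zero]

theorem not_injOn_of_rotation {q : SL(2, ℝ)} {ℓ : CotangentSL q}
    (hr : coord₁ q ℓ ^ 2 + coord₂ q ℓ ^ 2 ≠ 0)
    (hS : S (disc (-coord₀ q ℓ) (coord₁ q ℓ) (coord₂ q ℓ)) = 0)
    {U : Set (CotangentSL q)} (hU : U ∈ 𝓝 ℓ) :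
    ¬ Set.InjOn (expSL q) U := by
  set a := -coord₀ q ℓ
  set b := coord₁ q ℓ
  set c := coord₂ q ℓ
  have hdisc : ∀ s, disc a (b * Real.cos s - c * Real.sin s) (b * Real.sin s + c * Real.cos s) =
      disc a b c := by
    intro s
    simp only [disc]
    linear_combination (b ^ 2 + c ^ 2) * Real.sin_sq_add_cos_sq s
  refine not_injOn_of_curve hU
    (γ := fun s => (a, b * Real.cos s - c * Real.sin s, b * Real.sin s + c * Real.cos s)) (s := 0)
    (by fun_prop) (by simp [a, b, c]) fun N hN => ?_
  -- Within `(-2π, 2π)` the only angle with cosine `1` is `0`, so a nonzero `x` moves `(b, c)`.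
  obtain ⟨x, hx, hne⟩ := exists_mem_ne (Filter.inter_mem hN
    (Ioo_mem_nhds (neg_lt_zero.2 Real.two_pi_pos) Real.two_pi_pos))
  refine ⟨x, hx.1, 0, mem_of_mem_nhds hN, fun h => hne ?_, ?_⟩
  · have h1 : b * Real.cos x - c * Real.sin x = b * Real.cos 0 - c * Real.sin 0 :=
      congrArg (fun y => y.2.1) h
    have h2 : b * Real.sin x + c * Real.cos x = b * Real.sin 0 + c * Real.cos 0 :=
      congrArg (fun y => y.2.2) h
    rw [Real.cos_zero, Real.sin_zero] at h1 h2
    refine (Real.cos_eq_one_iff_of_lt_of_lt hx.2.1 hx.2.2).1 (mul_left_cancel₀ hr ?_)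
    linear_combination b * h1 + c * h2
  · have hE : ∀ s, expGen 1 a (b * Real.cos s - c * Real.sin s)
        (b * Real.sin s + c * Real.cos s) = expGen 1 a b c := by
      intro s
      simp only [expGen, one_pow, one_mul, hdisc, hS, zero_mul]
    simp only [flow, hE]

/-! ### Kernel of the differential. -/

theorem hasDerivAt_rot' (θ : ℝ) : HasDerivAt rot (mul (rot θ) (gen 1 0 0)) θ := by
  have hk : HasDerivAt (fun t : ℝ => t / 2) (1 / 2) θ := (hasDerivAt_id θ).div_const 2
  have hc := (Real.hasDerivAt_cos _).comp θ hk
  have hs := (Real.hasDerivAt_sin _).comp θ hk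
  rw [hasDerivAt_mat]
  intro i j
  fin_cases i <;> fin_cases j
  · exact hc.congr_deriv (by simp [mul_apply, rot, gen, div_eq_mul_inv])
  · exact hs.neg.congr_deriv (by simp [mul_apply, rot, gen]; ring)
  · exact hs.congr_deriv (by simp [mul_apply, rot, gen])
  · exact hc.congr_deriv (by simp [mul_apply, rot, gen]; ring)

theorem flow_mul_rot (a b c : ℝ) : mul (flow 1 a b c) (rot a) = expGen 1 a b c := by
  have h : mul (rot (-(1 * a))) (rot a) = one := by
    have h4 : -(1 * a) / 2 = -(a / 2) := by ring
    have h3 := Real.sin_sq_add_cos_sq (a / 2)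
    apply mat_ext <;> simp only [mul_apply, rot, h4, one, Real.cos_neg, Real.sin_neg,
      Matrix.cons_val_zero, Matrix.cons_val_one] <;> linarith
  rw [flow, mul_assoc', h, mul_one']

/-- Multiplying by `rot` leaves only `expGen` to differentiate. The trace gives `δ = -2aα`, hence
`bβ + cγ = 0`; the symmetric part then gives `δ = 0`, the skew part `α = 0`, and `β = γ = 0` follows
from `S ≠ 0`. -/
theorem eq_zero_of_hasDerivAt_flow {a b c α β γ : ℝ}
    (h : HasDerivAt (fun t => flow 1 (a + t * α) (b + t * β) (c + t * γ)) 0 0)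
    (hr : b ^ 2 + c ^ 2 ≠ 0) (hS : S (disc a b c) ≠ 0) (hS' : S' (disc a b c) ≠ 0) :
    α = 0 ∧ β = 0 ∧ γ = 0 := by
  have hlin : ∀ x y : ℝ, HasDerivAt (fun t : ℝ => x + t * y) y 0 := fun x y =>
    (((hasDerivAt_id (0 : ℝ)).mul_const y).const_add x).congr_deriv (by simp)
  have hrot : HasDerivAt (fun t : ℝ => rot (a + t * α)) (α • mul (rot a) (gen 1 0 0)) 0 := by
    have h0 : HasDerivAt rot (mul (rot a) (gen 1 0 0)) (a + 0 * α) := by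
      simpa using hasDerivAt_rot' a
    exact h0.scomp (0 : ℝ) (hlin a α)
  have hE := hasDerivAt_mul h hrot
  simp only [flow_mul_rot] at hE
  have hE' : HasDerivAt (fun t => expGen 1 (a + t * α) (b + t * β) (c + t * γ))
      (mul (expGen 1 a b c) (gen α 0 0)) 0 := by
    refine hE.congr_deriv ?_
    rw [← flow_mul_rot a b c]
    simp only [zero_mul, add_zero]
    apply mat_ext <;> simp only [mul_apply, gen, Pi.add_apply, Pi.smul_apply, Pi.zero_apply,
      smul_eq_mul, Matrix.cons_val_zero, Matrix.cons_val_one] <;> ring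
  set κ := disc a b c with hκ
  set δ := 2 * (b * β + c * γ - a * α) with hδ
  have hd : HasDerivAt (fun t => disc (a + t * α) (b + t * β) (c + t * γ)) δ 0 := by
    refine ((((hlin b β).pow 2).add ((hlin c γ).pow 2)).sub ((hlin a α).pow 2)).congr_deriv ?_
    simp only [zero_mul, add_zero]; norm_num [hδ]; ring
  have h0 : disc (a + 0 * α) (b + 0 * β) (c + 0 * γ) = κ := by simp [hκ]
  have hC : HasDerivAt (fun t => C (disc (a + t * α) (b + t * β) (c + t * γ))) (S κ / 8 * δ) 0 := by
    have := hasDerivAt_C (disc (a + 0 * α) (b + 0 * β) (c + 0 * γ))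
    exact (this.comp (0 : ℝ) hd).congr_deriv (by rw [h0])
  have hSd : HasDerivAt (fun t => S (disc (a + t * α) (b + t * β) (c + t * γ))) (S' κ * δ) 0 := by
    have := hasDerivAt_S (disc (a + 0 * α) (b + 0 * β) (c + 0 * γ))
    exact (this.comp (0 : ℝ) hd).congr_deriv (by rw [h0])
  rw [hasDerivAt_mat] at hE'
  have e00 := (hE' 0 0).unique (by
    simp only [expGen, one_pow, one_mul, Matrix.cons_val_zero]
    exact hC.add (hSd.mul ((hlin b β).div_const 2)))
  have e01 := (hE' 0 1).unique (by
    simp only [expGen, one_pow, one_mul, Matrix.cons_val_zero, Matrix.cons_val_one]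
    exact hSd.mul (((hlin c γ).sub (hlin a α)).div_const 2))
  have e10 := (hE' 1 0).unique (by
    simp only [expGen, one_pow, one_mul, Matrix.cons_val_zero, Matrix.cons_val_one]
    exact hSd.mul (((hlin c γ).add (hlin a α)).div_const 2))
  have e11 := (hE' 1 1).unique (by
    simp only [expGen, one_pow, one_mul, Matrix.cons_val_one]
    exact hC.sub (hSd.mul ((hlin b β).div_const 2)))
  simp only [mul_apply, expGen, gen, one_pow, one_mul, zero_mul, add_zero,
    Matrix.cons_val_zero, Matrix.cons_val_one, ← hκ] at e00 e01 e10 e11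
  have hd1 : δ = -2 * (a * α) := mul_left_cancel₀ hS (by linear_combination -4 * (e00 + e11))
  have horth : b * β + c * γ = 0 := by linear_combination hd1 / 2 - hδ / 2
  have e1 : S' κ * δ * b + S κ * β = S κ * c * α / 2 := by linear_combination -(e00 - e11)
  have e2 : S' κ * δ * c + S κ * γ = -(S κ * b * α / 2) := by linear_combination -(e01 + e10)
  have e3 : S' κ * δ * a + S κ * α = C κ * α := by linear_combination -(e10 - e01)
  have hδ0 : δ = 0 := by
    refine (mul_eq_zero.1 ?_).resolve_left (mul_ne_zero hS' hr)
    linear_combination b * e1 + c * e2 - S κ * horth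
  have haα : a * α = 0 := by linarith
  -- With `δ = 0`, `e3` reads `(C - S) α = 0`, that is `2κ S' α = 0`; as `aα = 0`, here `κα = (b² +
  -- c²)α`.
  have hα : α = 0 := by
    refine (mul_eq_zero.1 ?_).resolve_left (mul_ne_zero hS' hr)
    have hκ' : κ = b ^ 2 + c ^ 2 - a ^ 2 := rfl
    rw [hδ0] at e3
    linear_combination -S' κ * α * hκ' + α / 2 * two_mul_mul_S' κ - e3 / 2 + S' κ * a * haα
  rw [hδ0, hα] at e1 e2
  refine ⟨hα, mul_left_cancel₀ hS ?_, mul_left_cancel₀ hS ?_⟩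
  · linear_combination e1
  · linear_combination e2

theorem differentiable_C : Differentiable ℝ C := fun x => (hasDerivAt_C x).differentiableAt

theorem differentiable_S : Differentiable ℝ S := fun x => (hasDerivAt_S x).differentiableAt

theorem differentiable_flow (M : Mat) :
    Differentiable ℝ fun x : ℝ × ℝ × ℝ => mul M (flow 1 x.1 x.2.1 x.2.2) := by
  have hC := differentiable_C
  have hS := differentiable_S
  have hij : ∀ i j, Differentiable ℝ fun x : ℝ × ℝ × ℝ =>
      mul M (flow 1 x.1 x.2.1 x.2.2) i j := by
    intro i j
    fin_cases i <;> fin_cases j <;>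
      simp only [mul_apply, flow, expGen, rot, disc, Fin.zero_eta, Fin.mk_one,
        Matrix.cons_val_zero, Matrix.cons_val_one] <;> fun_prop
  have hi : ∀ i, Differentiable ℝ fun x : ℝ × ℝ × ℝ => mul M (flow 1 x.1 x.2.1 x.2.2) i :=
    fun i => differentiable_pi'' (hij i)
  exact differentiable_pi'' hi

/-- The coordinates of a covector in the left-invariant frame, up to the sign of the first. -/
def coordL (q : SL(2, ℝ)) : CotangentSL q →L[ℝ] ℝ × ℝ × ℝ :=
  (-ContinuousLinearMap.apply ℝ ℝ (leftInv q 1 0 0)).prod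
    ((ContinuousLinearMap.apply ℝ ℝ (leftInv q 0 1 0)).prod
      (ContinuousLinearMap.apply ℝ ℝ (leftInv q 0 0 1)))

theorem coordL_apply (q : SL(2, ℝ)) (ℓ : CotangentSL q) :
    coordL q ℓ = (-coord₀ q ℓ, coord₁ q ℓ, coord₂ q ℓ) := rfl

theorem differentiable_mat_expSL (q : SL(2, ℝ)) :
    Differentiable ℝ (fun ℓ : CotangentSL q => mat (expSL q ℓ)) := by
  have hL : Differentiable ℝ (coordL q) :=
    ContinuousLinearMap.differentiable (𝕜 := ℝ) (E := CotangentSL q) (F := ℝ × ℝ × ℝ) (coordL q)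
  have he : (fun ℓ : CotangentSL q => mat (expSL q ℓ)) =
      (fun x : ℝ × ℝ × ℝ => mul (mat q) (flow 1 x.1 x.2.1 x.2.2)) ∘ coordL q := by
    funext ℓ
    rw [Function.comp_apply, mat_expSL, coordL_apply]
  rw [he]
  exact Differentiable.comp (𝕜 := ℝ) (E := CotangentSL q) (F := ℝ × ℝ × ℝ) (G := Mat)
    (differentiable_flow (mat q)) hL

theorem conj_cases {q : SL(2, ℝ)} {ℓ : CotangentSL q} (h : ℓ ∈ Conj q) :
    coord₁ q ℓ ^ 2 + coord₂ q ℓ ^ 2 = 0 ∨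
      S (disc (-coord₀ q ℓ) (coord₁ q ℓ) (coord₂ q ℓ)) = 0 ∨
      S' (disc (-coord₀ q ℓ) (coord₁ q ℓ) (coord₂ q ℓ)) = 0 := by
  obtain ⟨-, v, hv, hdv⟩ := h
  by_contra! hne
  obtain ⟨hr, hS, hS'⟩ := hne
  have hL := HasFDerivAt.hasLineDerivAt (𝕜 := ℝ) (E := CotangentSL q) (F := Mat)
    ((differentiable_mat_expSL q ℓ).hasFDerivAt) v
  change HasDerivAt _ (dexpSL q ℓ v) 0 at hL
  rw [hdv] at hL
  have hF := hasDerivAt_mul (hasDerivAt_const (0 : ℝ) (adj (mat q))) hL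
  have hF' : HasDerivAt (fun t => flow 1 (-coord₀ q ℓ + t * -coord₀ q v)
      (coord₁ q ℓ + t * coord₁ q v) (coord₂ q ℓ + t * coord₂ q v)) 0 0 := by
    refine (hF.congr_deriv ?_).congr_of_eventuallyEq (Filter.Eventually.of_forall fun t => ?_)
    · ext i j; simp [mul_apply]
    · simp only [mat_expSL]
      rw [← mul_assoc', adj_mul (det_mat q), one_mul']
      simp only [coord₀, coord₁, coord₂, add_apply, smul_apply, smul_eq_mul]
      congr 1
      ring
  obtain ⟨h0, h1, h2⟩ := eq_zero_of_hasDerivAt_flow hF' hr hS hS'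
  refine hv (cotangent_ext ?_ ?_ ?_)
  · rw [neg_eq_zero.1 h0]; simp [coord₀]
  · rw [h1]; simp [coord₁]
  · rw [h2]; simp [coord₂]

/-! ### The fold. -/

theorem deriv_eq_zero_of_monotoneOn {f k : ℝ → ℝ} {x₀ δ k' : ℝ} (hδ : 0 < δ)
    (hf : ∀ x ∈ Set.Icc (x₀ - δ) (x₀ + δ), HasDerivAt f (k x) x) (hk : HasDerivAt k k' x₀)
    (hk0 : k x₀ = 0) (hm : MonotoneOn f (Set.Icc (x₀ - δ) (x₀ + δ))) : k' = 0 := by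
  refine IsLocalMin.hasDerivAt_eq_zero (f := k) (a := x₀) ?_ hk
  filter_upwards [Ioo_mem_nhds (sub_lt_self x₀ hδ) (lt_add_of_pos_right x₀ hδ)] with x hx
  have hmem : Set.Icc (x₀ - δ) (x₀ + δ) ∈ 𝓝 x := Icc_mem_nhds hx.1 hx.2
  rw [hk0, ← (hf x ⟨hx.1.le, hx.2.le⟩).deriv, ← derivWithin_of_mem_nhds hmem]
  exact hm.derivWithin_nonneg

/-- A continuous injective function on an interval is strictly monotone; its derivative `k` would
then have a local extremum at its zero `x₀`, forcing `k' = 0`. -/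
theorem exists_ne_eq_of_fold {f k : ℝ → ℝ} {x₀ k' : ℝ}
    (hf : ∀ᶠ x in 𝓝 x₀, HasDerivAt f (k x) x) (hk : HasDerivAt k k' x₀) (hk0 : k x₀ = 0)
    (hk' : k' ≠ 0) {N : Set ℝ} (hN : N ∈ 𝓝 x₀) : ∃ x ∈ N, ∃ y ∈ N, x ≠ y ∧ f x = f y := by
  by_contra! h
  obtain ⟨δ, hδ, hball⟩ := Metric.nhds_basis_closedBall.mem_iff.1 (Filter.inter_mem hN hf)
  rw [Real.closedBall_eq_Icc] at hball
  have hd : ∀ x ∈ Set.Icc (x₀ - δ) (x₀ + δ), HasDerivAt f (k x) x := fun x hx => (hball hx).2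
  have hinj : Set.InjOn f (Set.Icc (x₀ - δ) (x₀ + δ)) := fun x hx y hy hxy => by
    by_contra hne
    exact h x (hball hx).1 y (hball hy).1 hne hxy
  have hcont : ContinuousOn f (Set.Icc (x₀ - δ) (x₀ + δ)) := fun x hx =>
    (hd x hx).continuousAt.continuousWithinAt
  rcases hcont.strictMonoOn_of_injOn_Icc' (by linarith) hinj with hm | hm
  · exact hk' (deriv_eq_zero_of_monotoneOn hδ hd hk hk0 hm.monotoneOn)
  · refine hk' (neg_eq_zero.1 ?_)
    exact deriv_eq_zero_of_monotoneOn (f := -f) (k := -k) hδ (fun x hx => (hd x hx).neg) hk.neg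
      (by simp [hk0]) hm.antitoneOn.neg

/-- The solution `a` with the sign of `a₀` of `G / S κ ^ 2 - a ^ 2 = κ`. -/
def branch (G a₀ κ : ℝ) : ℝ := a₀ * √((G / S κ ^ 2 - κ) / a₀ ^ 2)

theorem branch_sq {G a₀ κ : ℝ} (ha : a₀ ≠ 0) (h : 0 < G / S κ ^ 2 - κ) :
    branch G a₀ κ ^ 2 = G / S κ ^ 2 - κ := by
  rw [branch, mul_pow, Real.sq_sqrt (by positivity)]
  field_simp

theorem branch_ne_zero {G a₀ κ : ℝ} (ha : a₀ ≠ 0) (h : 0 < G / S κ ^ 2 - κ) :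
    branch G a₀ κ ≠ 0 := by
  intro h0
  have := branch_sq ha h
  rw [h0] at this
  linarith

theorem exists_hasDerivAt_branch {G a₀ κ : ℝ} (ha : a₀ ≠ 0) (hS : S κ ≠ 0)
    (h : 0 < G / S κ ^ 2 - κ) : ∃ a', HasDerivAt (branch G a₀) a' κ ∧
      2 * branch G a₀ κ * a' = -2 * (G * S' κ / S κ ^ 3) - 1 := by
  have hφ : HasDerivAt (fun κ => G / S κ ^ 2 - κ) (-2 * (G * S' κ / S κ ^ 3) - 1) κ := by
    refine (((hasDerivAt_const κ G).div ((hasDerivAt_S κ).pow 2) (pow_ne_zero 2 hS)).sub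
      (hasDerivAt_id κ)).congr_deriv ?_
    simp only [Pi.pow_apply]
    field_simp
    ring
  have hpos : 0 < (G / S κ ^ 2 - κ) / a₀ ^ 2 := by positivity
  refine ⟨_, ((hφ.div_const (a₀ ^ 2)).sqrt hpos.ne').const_mul a₀, ?_⟩
  have := (Real.sqrt_pos.2 hpos).ne'
  rw [branch]
  generalize -2 * (G * S' κ / S κ ^ 3) - 1 = d
  generalize √((G / S κ ^ 2 - κ) / a₀ ^ 2) = s at this ⊢
  field_simp

/-- Half the trace of `flow 1 a b c` for `disc a b c = κ`. -/
def polarX (a κ : ℝ) : ℝ := C κ * Real.cos (a / 2) + S κ * a / 2 * Real.sin (a / 2)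

/-- The skew-symmetric part of `flow 1 a b c` for `disc a b c = κ`. -/
def polarY (a κ : ℝ) : ℝ := S κ * a / 2 * Real.cos (a / 2) - C κ * Real.sin (a / 2)

theorem polar_sq (a κ : ℝ) :
    polarX a κ ^ 2 + polarY a κ ^ 2 = 1 + S κ ^ 2 * (a ^ 2 + κ) / 4 := by
  simp only [polarX, polarY]
  linear_combination (C κ ^ 2 + S κ ^ 2 * a ^ 2 / 4) * Real.sin_sq_add_cos_sq (a / 2) + C_sq_sub κ

/-- In the frame turned by `a/2` the point is `(C, S a / 2)`; `h1` and `h2` say that, with the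
turning of the frame included, it moves on a circle with angular speed `T`. -/
theorem hasDerivAt_polar {a : ℝ → ℝ} {κ a' G T : ℝ} (ha : HasDerivAt a a' κ) (ha0 : a κ ≠ 0)
    (hG : S κ ^ 2 * (a κ ^ 2 + κ) = G) (hS : S κ ≠ 0)
    (ha' : 2 * a κ * a' = -2 * (G * S' κ / S κ ^ 3) - 1)
    (hT : T = G * S' κ / (2 * a κ * S κ ^ 3)) :
    HasDerivAt (fun κ => polarX (a κ) κ) (-(T * polarY (a κ) κ)) κ ∧
      HasDerivAt (fun κ => polarY (a κ) κ) (T * polarX (a κ) κ) κ := by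
  have hT' : G * S' κ / S κ ^ 3 = 2 * a κ * T := by rw [hT]; field_simp
  have hGT : S' κ * (a κ ^ 2 + κ) = 2 * a κ * T * S κ := by
    rw [← hT', ← hG]; field_simp
  rw [hT'] at ha'
  have h1 : S κ / 8 + S κ * a κ * a' / 4 = -T * S κ * a κ / 2 := by
    linear_combination S κ / 8 * ha'
  have h2 : (S' κ * a κ + S κ * a' - C κ * a') / 2 = T * C κ := by
    refine mul_left_cancel₀ (mul_ne_zero two_ne_zero ha0) ?_
    linear_combination hGT + (S κ - C κ) / 2 * ha' - 1 / 2 * two_mul_mul_S' κ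
  have hc := (Real.hasDerivAt_cos _).comp κ (ha.div_const 2)
  have hs := (Real.hasDerivAt_sin _).comp κ (ha.div_const 2)
  have hSa := (((hasDerivAt_S κ).mul ha).div_const 2)
  constructor
  · refine (((hasDerivAt_C κ).mul hc).add (hSa.mul hs)).congr_deriv ?_
    simp only [polarY, Function.comp_apply, Pi.mul_apply]
    linear_combination Real.cos (a κ / 2) * h1 + Real.sin (a κ / 2) * h2
  · refine ((hSa.mul hc).sub ((hasDerivAt_C κ).mul hs)).congr_deriv ?_
    simp only [polarX, Function.comp_apply, Pi.mul_apply]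
    linear_combination Real.cos (a κ / 2) * h2 - Real.sin (a κ / 2) * h1

/-- The coordinates of the point with discriminant `κ` and angular coordinate `a` for which the
symmetric traceless part of `flow` is given by `g₁` and `g₂`. -/
def foldCurve (g₁ g₂ a κ : ℝ) : ℝ × ℝ × ℝ :=
  (a, (g₁ * Real.cos (a / 2) + g₂ * Real.sin (a / 2)) / S κ,
    (g₂ * Real.cos (a / 2) - g₁ * Real.sin (a / 2)) / S κ)

theorem disc_foldCurve (g₁ g₂ a κ : ℝ) :
    disc (foldCurve g₁ g₂ a κ).1 (foldCurve g₁ g₂ a κ).2.1 (foldCurve g₁ g₂ a κ).2.2 =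
      (g₁ ^ 2 + g₂ ^ 2) / S κ ^ 2 - a ^ 2 := by
  simp only [disc, foldCurve]
  linear_combination (g₁ ^ 2 + g₂ ^ 2) / S κ ^ 2 * Real.sin_sq_add_cos_sq (a / 2)

theorem flow_foldCurve {g₁ g₂ a κ : ℝ} (hS : S κ ≠ 0)
    (h : (g₁ ^ 2 + g₂ ^ 2) / S κ ^ 2 - a ^ 2 = κ) :
    flow 1 (foldCurve g₁ g₂ a κ).1 (foldCurve g₁ g₂ a κ).2.1 (foldCurve g₁ g₂ a κ).2.2 =
      ![![polarX a κ + g₁ / 2, g₂ / 2 - polarY a κ],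
        ![g₂ / 2 + polarY a κ, polarX a κ - g₁ / 2]] := by
  have h3 := Real.sin_sq_add_cos_sq (a / 2)
  simp only [flow, expGen, disc_foldCurve, h, one_pow, one_mul]
  simp only [foldCurve]
  apply mat_ext <;> simp only [mul_apply, rot, polarX, polarY, Real.cos_neg, Real.sin_neg,
    Matrix.cons_val_zero, Matrix.cons_val_one, neg_div] <;> field_simp
  · linear_combination g₁ * h3
  · linear_combination g₂ * h3
  · linear_combination g₂ * h3
  · linear_combination -g₁ * h3

theorem not_injOn_of_fold {q : SL(2, ℝ)} {ℓ : CotangentSL q}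
    (hr : coord₁ q ℓ ^ 2 + coord₂ q ℓ ^ 2 ≠ 0)
    (hS' : S' (disc (-coord₀ q ℓ) (coord₁ q ℓ) (coord₂ q ℓ)) = 0)
    {U : Set (CotangentSL q)} (hU : U ∈ 𝓝 ℓ) :
    ¬ Set.InjOn (expSL q) U := by
  set a₀ := -coord₀ q ℓ
  set b := coord₁ q ℓ
  set c := coord₂ q ℓ
  set κ₀ := disc a₀ b c with hκ₀
  have hκ : κ₀ = b ^ 2 + c ^ 2 - a₀ ^ 2 := rfl
  have hS₀ : S κ₀ ≠ 0 := S_ne_zero_of_S' hS'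
  have hκneg : κ₀ < 0 := by
    by_contra! h
    exact (S'_pos h).ne' hS'
  -- Otherwise `κ₀ = b² + c² ≥ 0`.
  have ha₀ : a₀ ≠ 0 := by
    intro h
    rw [h] at hκ
    nlinarith [sq_nonneg b, sq_nonneg c]
  -- Twice the symmetric traceless part of `flow` at `ℓ`, to be kept fixed.
  set g₁ := S κ₀ * (b * Real.cos (a₀ / 2) - c * Real.sin (a₀ / 2))
  set g₂ := S κ₀ * (b * Real.sin (a₀ / 2) + c * Real.cos (a₀ / 2))
  set G := g₁ ^ 2 + g₂ ^ 2
  have hG : G = S κ₀ ^ 2 * (b ^ 2 + c ^ 2) := by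
    simp only [G, g₁, g₂]
    linear_combination S κ₀ ^ 2 * (b ^ 2 + c ^ 2) * Real.sin_sq_add_cos_sq (a₀ / 2)
  have hφ₀ : G / S κ₀ ^ 2 - κ₀ = a₀ ^ 2 := by
    rw [hG, mul_div_cancel_left₀ _ (pow_ne_zero 2 hS₀)]; linarith
  have hG0 : 0 < G := by
    rw [hG]; positivity
  have hbr₀ : branch G a₀ κ₀ = a₀ := by
    rw [branch, hφ₀, div_self (pow_ne_zero 2 ha₀), Real.sqrt_one, mul_one]
  have hpos₀ : 0 < G / S κ₀ ^ 2 - κ₀ := by rw [hφ₀]; positivity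
  let X := fun κ => polarX (branch G a₀ κ) κ
  let Y := fun κ => polarY (branch G a₀ κ) κ
  -- Up to the constant `1 + G/4`, `P` and `f` are cosine and sine of the angle from `(X, Y)` at
  -- `κ₀`; where `P > 0`, `f` determines the point.
  let P := fun κ => X κ * X κ₀ + Y κ * Y κ₀
  let f := fun κ => Y κ * X κ₀ - X κ * Y κ₀
  let T := fun κ => G * S' κ / (2 * branch G a₀ κ * S κ ^ 3)
  have hsq : ∀ κ, S κ ≠ 0 → 0 < G / S κ ^ 2 - κ → S κ ^ 2 * (branch G a₀ κ ^ 2 + κ) = G := by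
    intro κ h1 h2
    rw [branch_sq ha₀ h2]; field_simp; ring
  have hXY : ∀ κ, S κ ≠ 0 → 0 < G / S κ ^ 2 - κ → HasDerivAt X (-(T κ * Y κ)) κ ∧
      HasDerivAt Y (T κ * X κ) κ := by
    intro κ h1 h2
    obtain ⟨a', h3, h4⟩ := exists_hasDerivAt_branch ha₀ h1 h2
    exact hasDerivAt_polar h3 (branch_ne_zero ha₀ h2) (hsq κ h1 h2) h1 h4 rfl
  have hnorm : ∀ κ, S κ ≠ 0 → 0 < G / S κ ^ 2 - κ → X κ ^ 2 + Y κ ^ 2 = 1 + G / 4 := by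
    intro κ h1 h2
    rw [← hsq κ h1 h2]
    exact polar_sq _ _
  have hP₀ : P κ₀ = 1 + G / 4 := by rw [← hnorm κ₀ hS₀ hpos₀]; simp only [P]; ring
  have hScont : ContinuousAt S κ₀ := (hasDerivAt_S κ₀).continuousAt
  obtain ⟨a', hbr, -⟩ := exists_hasDerivAt_branch ha₀ hS₀ hpos₀
  have hbrcont := hbr.continuousAt
  have hdX := (hXY κ₀ hS₀ hpos₀).1.differentiableAt
  have hdY := (hXY κ₀ hS₀ hpos₀).2.differentiableAt
  have hdP : DifferentiableAt ℝ P κ₀ := (hdX.mul_const _).add (hdY.mul_const _)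
  have hφcont : ContinuousAt (fun κ => G / S κ ^ 2 - κ) κ₀ :=
    (continuousAt_const.div (hScont.pow 2) (pow_ne_zero 2 hS₀)).sub continuousAt_id
  have hgood : ∀ᶠ κ in 𝓝 κ₀, S κ ≠ 0 ∧ 0 < G / S κ ^ 2 - κ ∧ 0 < P κ ∧ κ < 0 := by
    filter_upwards [hScont.eventually_ne hS₀, hφcont.eventually (lt_mem_nhds hpos₀),
      hdP.continuousAt.eventually (lt_mem_nhds (show (0 : ℝ) < P κ₀ by rw [hP₀]; positivity)),
      gt_mem_nhds hκneg] with κ h1 h2 h3 h4 using ⟨h1, h2, h3, h4⟩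
  -- Here `f' = T P`, with `S'` replaced by `(C - S) / (2κ)`; this needs `κ ≠ 0`.
  let n := fun κ => G * P κ / (4 * κ * branch G a₀ κ * S κ ^ 3)
  let k := fun κ => (C κ - S κ) * n κ
  have hfk : ∀ᶠ κ in 𝓝 κ₀, HasDerivAt f (k κ) κ := by
    filter_upwards [hgood] with κ ⟨h1, h2, _, h4⟩
    obtain ⟨hX, hY⟩ := hXY κ h1 h2
    have h5 := branch_ne_zero ha₀ h2
    refine ((hY.mul_const _).sub (hX.mul_const _)).congr_deriv ?_
    simp only [k, n, T, ← two_mul_mul_S']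
    have h6 := h4.ne
    simp only [P]
    field_simp
    ring
  have hn0 : n κ₀ ≠ 0 := by
    have : 1 + G / 4 ≠ 0 := by positivity
    have h6 := hκneg.ne
    simp only [n, hP₀, hbr₀]
    exact div_ne_zero (mul_ne_zero hG0.ne' this)
      (mul_ne_zero (mul_ne_zero (mul_ne_zero (by norm_num) h6) ha₀) (pow_ne_zero 3 hS₀))
  have hn : DifferentiableAt ℝ n κ₀ := by
    refine (hdP.const_mul G).div ((((differentiableAt_id).const_mul 4).mul
      hbr.differentiableAt).mul ((hasDerivAt_S κ₀).differentiableAt.pow 3)) ?_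
    have h6 := hκneg.ne
    rw [← hbr₀] at ha₀
    exact mul_ne_zero (mul_ne_zero (mul_ne_zero (by norm_num) h6) ha₀) (pow_ne_zero 3 hS₀)
  have hCS : C κ₀ - S κ₀ = 0 := by rw [← two_mul_mul_S', hS', mul_zero]
  have hk : HasDerivAt k (S κ₀ / 8 * n κ₀) κ₀ := by
    refine (((hasDerivAt_C κ₀).sub (hasDerivAt_S κ₀)).mul hn.hasDerivAt).congr_deriv ?_
    simp [hCS, hS']
  have hk0 : k κ₀ = 0 := by simp only [k, hCS, zero_mul]
  refine not_injOn_of_curve hU (γ := fun κ => foldCurve g₁ g₂ (branch G a₀ κ) κ) (s := κ₀) ?_ ?_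
    fun N hN => ?_
  · simp only [foldCurve]
    fun_prop (disch := assumption)
  · have h3 := Real.sin_sq_add_cos_sq (a₀ / 2)
    simp only [foldCurve, hbr₀, g₁, g₂]
    refine Prod.ext rfl (Prod.ext ?_ ?_) <;> simp only <;> field_simp
    · linear_combination b * h3
    · linear_combination c * h3
  · obtain ⟨x, ⟨hxN, hx1, hx2, hx3, -⟩, y, ⟨hyN, hy1, hy2, hy3, -⟩, hxy, hfxy⟩ :=
      exists_ne_eq_of_fold hfk hk hk0 (mul_ne_zero (by positivity) hn0)
        (Filter.inter_mem hN hgood)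
    have hdx : (g₁ ^ 2 + g₂ ^ 2) / S x ^ 2 - branch G a₀ x ^ 2 = x := by
      rw [branch_sq ha₀ hx2]; ring
    have hdy : (g₁ ^ 2 + g₂ ^ 2) / S y ^ 2 - branch G a₀ y ^ 2 = y := by
      rw [branch_sq ha₀ hy2]; ring
    refine ⟨x, hxN, y, hyN, fun h => hxy ?_, ?_⟩
    -- The discriminant recovers the parameter, so the fold curve is injective.
    · rw [← hdx, ← disc_foldCurve, h, disc_foldCurve, hdy]
    · have hM := hnorm κ₀ hS₀ hpos₀
      have hMx := hnorm x hx1 hx2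
      have hMy := hnorm y hy1 hy2
      have hM0 : 1 + G / 4 ≠ 0 := by positivity
      have hPf : ∀ κ, P κ ^ 2 + f κ ^ 2 = (X κ ^ 2 + Y κ ^ 2) * (X κ₀ ^ 2 + Y κ₀ ^ 2) := by
        intro κ; simp only [P, f]; ring
      have hPP : P x = P y := by
        refine (sq_eq_sq₀ hx3.le hy3.le).1 ?_
        have e1 := hPf x
        have e2 := hPf y
        rw [hMx] at e1
        rw [hMy] at e2
        rw [hfxy] at e1
        linarith
      have hX : X x = X y := by
        have e : ∀ κ, X κ * (X κ₀ ^ 2 + Y κ₀ ^ 2) = P κ * X κ₀ - f κ * Y κ₀ := by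
          intro κ; simp only [P, f]; ring
        refine mul_right_cancel₀ hM0 ?_
        rw [← hM, e, e, hPP, hfxy]
      have hY : Y x = Y y := by
        have e : ∀ κ, Y κ * (X κ₀ ^ 2 + Y κ₀ ^ 2) = P κ * Y κ₀ + f κ * X κ₀ := by
          intro κ; simp only [P, f]; ring
        refine mul_right_cancel₀ hM0 ?_
        rw [← hM, e, e, hPP, hfxy]
      simp only [flow_foldCurve hx1 hdx, flow_foldCurve hy1 hdy]
      simp only [X, Y] at hX hY
      rw [hX, hY]

end SubRiemannianSL2

end

theorem mainTheorem12 (q : Matrix.SpecialLinearGroup (Fin 2) ℝ) :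
    SubRiemannianSL2.expDomain q = Set.univ ∧
    ∀ ℓ₀ ∈ SubRiemannianSL2.Conj q, ∀ U ∈ nhds ℓ₀,
      ¬ Set.InjOn (SubRiemannianSL2.expSL q) U := by
  refine ⟨Set.eq_univ_of_forall (SubRiemannianSL2.exists_isNormalExtremal q), fun ℓ hℓ U hU => ?_⟩
  by_cases hr : SubRiemannianSL2.coord₁ q ℓ ^ 2 + SubRiemannianSL2.coord₂ q ℓ ^ 2 = 0
  · obtain ⟨h1, h2⟩ := (add_eq_zero_iff_of_nonneg (sq_nonneg _) (sq_nonneg _)).1 hr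
    exact SubRiemannianSL2.not_injOn_of_vertical (pow_eq_zero_iff two_ne_zero |>.1 h1)
      (pow_eq_zero_iff two_ne_zero |>.1 h2) hU
  · rcases (SubRiemannianSL2.conj_cases hℓ).resolve_left hr with h | h
    · exact SubRiemannianSL2.not_injOn_of_rotation hr h hU
    · exact SubRiemannianSL2.not_injOn_of_fold hr h hU
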